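/- Let $(\Omega,\mathcal B,\mathbf P)$ be a probability space, $T:\Omega\to\Omega$ an invertible (bi-measurable) measure-preserving ergodic transformation, $\mathcal Y\subseteq\mathcal B$ a sub-$\sigma$-field, and $(U,\mathcal U)$ a nonempty measurable space. Put $\mathcal Y_{m,n}=\bigvee_{m\le k\le n}T^{-k}\mathcal Y$ for $-\infty\le m\le n$. Let $\ell:U\times\Omega\to\mathbb R$ be jointly measurable with $|\ell(u,\omega)|\le\Lambda(\omega)$ for some $\Lambda\in L^1(\mathbf P)$; for a (possibly random) decision $u:\Omega\to U$ write $\ell_k(u)(\omega)=\ell(u(\omega),T^k\omega)$. A strategy $\mathbf u=(u_k)_{k\ge1}$, $u_k:\Omega\to U$, is admissible if $u_k$ is $\mathcal Y_{0,k}$-measurable for every $k\ge 1$, and its time-average loss is $L_N(\mathbf u)=\frac1N\sum_{k=1}^N\ell_k(u_k)$. An admissible strategy $\mathbf u^\star$ is *pathwise optimal* if $\liminf_{N\to\infty}\{L_N(\mathbf u)-L_N(\mathbf u^\star)\}\ge0$ a.s. for every admissible $\mathbf u$, and *weakly pathwise optimal* if $\mathbf P[L_N(\mathbf u)-L_N(\mathbf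 u^\star)\ge-\varepsilon]\to1$ as $N\to\infty$ for every $\varepsilon>0$ and every admissible $\mathbf u$. A *mean-optimal selection* is an admissible strategy $\tilde{\mathbf u}$ such that, for every $k\ge1$, $$\mathbf E[\ell_k(\tilde u_k)\mid\mathcal Y_{0,k}]\le\operatorname*{ess\,inf}_{v}\mathbf E[\ell_k(v)\mid\mathcal Y_{0,k}]+k^{-1}\quad\text{a.s.},$$ where $v$ ranges over all $\mathcal Y_{0,k}$-measurable maps $\Omega\to U$. Assume that * $\ell$ is *equimeasurable*: for every $\varepsilon>0$ there is $\Omega_\varepsilon\in\mathcal B$ with $\mathbf P[\Omega_\varepsilon]\ge1-\varepsilon$ such that $\{\ell(u,\cdot)\mathbf 1_{\Omega_\varepsilon}:u\in U\}$ is a totally bounded subset of $L^\infty(\mathbf P)$; * $\ell$ is *pointwise separable*: there are a countable $U_0\subseteq U$ and a set $\Omega_0\subseteq\Omega$ of full measure such that for every $u\in U$ there is a sequence $(v_n)$ in $U_0$ with $\ell(v_n,\omega)\to\ell(u,\omega)$ for all $\omega\in\Omega_0$ (this is automatic if $U$ is countable, or if $U$ is a separable metric space and $u\mapsto\ell(u,\omega)$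 is continuous for a.e. $\omega$). Then a mean-optimal selection exists, and the following hold. 1. Suppose that $(\Omega,\mathcal B,\mathbf P,T)$ is a conditional $K$-automorphism relative to $\mathcal Z=\mathcal Y_{-\infty,0}$, that is, there is a $\sigma$-field $\mathcal X\subseteq\mathcal B$ with $\mathcal X\subseteq T^{-1}\mathcal X$, $\bigvee_{k\ge1}T^{-k}\mathcal X=\mathcal B$ mod $\mathbf P$, and $\bigcap_{k\ge1}(\mathcal Z\vee T^k\mathcal X)=\mathcal Z$ mod $\mathbf P$. Then every mean-optimal selection $\tilde{\mathbf u}$ is pathwise optimal. 2. Suppose that $(\Omega,\mathcal B,\mathbf P,T)$ is conditionally weak mixing relative to $\mathcal Z=\mathcal Y_{-\infty,0}$, that is, for all $A,B\in\mathcal B$, $$\frac1N\sum_{k=1}^N\bigl|\mathbf P[A\cap T^kB\mid\mathcal Z]-\mathbf P[A\mid\mathcal Z]\,\mathbf P[T^kB\mid\mathcal Z]\bigr|\to0\quad\text{in }L^1\text{ as }N\to\infty.$$ Then every mean-optimal selection $\tilde{\mathbf u}$ is weakly pathwise optimal. -/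

import Mathlib

open MeasureTheory Filter Topology
open scoped ENNReal

noncomputable section

namespace PathwiseDecision

variable {Ω : Type*} {U : Type*}

/-- The integer powers `T^k` of an invertible transformation, as maps `Ω → Ω`. -/
def iter (T : Equiv.Perm Ω) (k : ℤ) : Ω → Ω :=
  ⇑(T ^ k)

/-- The σ-field `T^{-k} 𝒳 = {(T^k)⁻¹(A) : A ∈ 𝒳}`; thus `T^k 𝒳` is `pull T (-k) 𝒳`. -/
@[reducible]
def pull (T : Equiv.Perm Ω) (k : ℤ) (X : MeasurableSpace Ω) : MeasurableSpace Ω :=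
  X.comap (iter T k)

/-- The σ-field `⋁_{k ∈ I} T^{-k} 𝒴` of what is observed at the times `k ∈ I`.
`𝒴_{0,n}` is `obs T Y (Set.Icc 0 n)` and `𝒴_{-∞,0}` is `obs T Y (Set.Iic 0)`. -/
@[reducible]
def obs (T : Equiv.Perm Ω) (Y : MeasurableSpace Ω) (I : Set ℤ) :
    MeasurableSpace Ω :=
  ⨆ k ∈ I, pull T k Y

/-- Equality of two σ-fields modulo `P`-null sets. -/
def EqMod {mΩ : MeasurableSpace Ω} (P : Measure Ω) (m₁ m₂ : MeasurableSpace Ω) : Prop :=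
  (∀ s, MeasurableSet[m₁] s → ∃ t, MeasurableSet[m₂] t ∧ s =ᵐ[P] t) ∧
  (∀ t, MeasurableSet[m₂] t → ∃ s, MeasurableSet[m₁] s ∧ s =ᵐ[P] t)

/-- Conditional `K`-automorphism relative to the σ-field `Z`. -/
def IsCondKAutomorphism (Z : MeasurableSpace Ω) {mΩ : MeasurableSpace Ω} (P : Measure Ω)
    (T : Equiv.Perm Ω) : Prop :=
  ∃ X : MeasurableSpace Ω, X ≤ mΩ ∧
    X ≤ pull T 1 X ∧
    EqMod P (⨆ k : ℕ, ⨆ _ : 1 ≤ k, pull T k X) mΩ ∧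
    EqMod P (⨅ k : ℕ, ⨅ _ : 1 ≤ k, Z ⊔ pull T (-(k : ℤ)) X) Z

/-- The conditional probability `P[A | Z]`. -/
def condProb (Z : MeasurableSpace Ω) {mΩ : MeasurableSpace Ω} (P : Measure Ω) (A : Set Ω) : Ω → ℝ :=
  P[A.indicator (fun _ => (1 : ℝ)) | Z]

/-- Conditional weak mixing relative to the σ-field `Z`. -/
def IsCondWeakMixing (Z : MeasurableSpace Ω) {mΩ : MeasurableSpace Ω} (P : Measure Ω)
    (T : Equiv.Perm Ω) : Prop :=
  ∀ A B : Set Ω, MeasurableSet A → MeasurableSet B →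
    Tendsto (fun N : ℕ => eLpNorm (fun ω => (1 / (N : ℝ)) * ∑ k ∈ Finset.Icc 1 N,
        |condProb Z P (A ∩ iter T k '' B) ω
          - condProb Z P A ω * condProb Z P (iter T k '' B) ω|) 1 P)
      atTop (𝓝 0)

/-- The loss `ℓ_k(v)(ω) = ℓ(v(ω), T^k ω)` of a (possibly random) decision `v` at time `k`. -/
def lossAt (T : Equiv.Perm Ω) (ℓ : U → Ω → ℝ) (k : ℕ) (v : Ω → U) : Ω → ℝ :=
  fun ω => ℓ (v ω) (iter T k ω)

/-- The time-average loss `L_N(u) = N⁻¹ ∑_{k=1}^N ℓ_k(u_k)`. -/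
def avgLoss (T : Equiv.Perm Ω) (ℓ : U → Ω → ℝ) (u : ℕ → Ω → U) (N : ℕ) : Ω → ℝ :=
  fun ω => (1 / (N : ℝ)) * ∑ k ∈ Finset.Icc 1 N, lossAt T ℓ k (u k) ω

/-- A strategy `(u_k)_{k ≥ 1}` is admissible if `u_k` is `𝒴_{0,k}`-measurable for every `k ≥ 1`
(the value at `k = 0` is not used anywhere). -/
def Admissible [MeasurableSpace U] (T : Equiv.Perm Ω) (Y : MeasurableSpace Ω)
    (u : ℕ → Ω → U) : Prop :=
  ∀ k : ℕ, 1 ≤ k → Measurable[obs T Y (Set.Icc 0 (k : ℤ))] (u k)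

/-- Pathwise optimality; the lower limit is taken in the extended reals. -/
def PathwiseOptimal (Y : MeasurableSpace Ω) {mΩ : MeasurableSpace Ω} [MeasurableSpace U]
    (P : Measure Ω) (T : Equiv.Perm Ω) (ℓ : U → Ω → ℝ) (ustar : ℕ → Ω → U) : Prop :=
  Admissible T Y ustar ∧ ∀ u : ℕ → Ω → U, Admissible T Y u →
    ∀ᵐ ω ∂P, (0 : EReal) ≤
      liminf (fun N : ℕ => ((avgLoss T ℓ u N ω - avgLoss T ℓ ustar N ω : ℝ) : EReal)) atTop

/-- Weak pathwise optimality. -/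
def WeaklyPathwiseOptimal (Y : MeasurableSpace Ω) {mΩ : MeasurableSpace Ω} [MeasurableSpace U]
    (P : Measure Ω) (T : Equiv.Perm Ω) (ℓ : U → Ω → ℝ) (ustar : ℕ → Ω → U) : Prop :=
  Admissible T Y ustar ∧ ∀ u : ℕ → Ω → U, Admissible T Y u → ∀ ε : ℝ, 0 < ε →
    Tendsto (fun N : ℕ => P {ω | -ε ≤ avgLoss T ℓ u N ω - avgLoss T ℓ ustar N ω}) atTop (𝓝 1)

/-- `g` is (a version of) the essential infimum of the family `F` of real functions. -/
def IsEssInf [MeasurableSpace Ω] (P : Measure Ω) (F : Set (Ω → ℝ)) (g : Ω → ℝ) : Prop :=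
  Measurable g ∧ (∀ f ∈ F, g ≤ᵐ[P] f) ∧
    ∀ h : Ω → ℝ, Measurable h → (∀ f ∈ F, h ≤ᵐ[P] f) → h ≤ᵐ[P] g

/-- The mean-optimal strategy `ũ`: an admissible strategy with
`E[ℓ_k(ũ_k) | 𝒴_{0,k}] ≤ ess inf_v E[ℓ_k(v) | 𝒴_{0,k}] + 1/k` a.s. for every `k ≥ 1`, where `v`
ranges over all `𝒴_{0,k}`-measurable decisions. -/
def IsMeanOptimalSelection (Y : MeasurableSpace Ω) {mΩ : MeasurableSpace Ω} [MeasurableSpace U]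
    (P : Measure Ω) (T : Equiv.Perm Ω) (ℓ : U → Ω → ℝ) (u : ℕ → Ω → U) : Prop :=
  Admissible T Y u ∧ ∀ k : ℕ, 1 ≤ k → ∃ g : Ω → ℝ,
    IsEssInf P {f | ∃ v : Ω → U, Measurable[obs T Y (Set.Icc 0 (k : ℤ))] v ∧
        f = P[lossAt T ℓ k v | obs T Y (Set.Icc 0 (k : ℤ))]} g ∧
    ∀ᵐ ω ∂P, (P[lossAt T ℓ k (u k) | obs T Y (Set.Icc 0 (k : ℤ))]) ω ≤ g ω + 1 / (k : ℝ)

/-- Equimeasurability (Grothendieck): for every `ε > 0` there is a measurable `S` with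
`P(S) ≥ 1 - ε` such that `{ℓ(u, ·) 1_S : u ∈ U}` is a totally bounded subset of `L^∞(P)`. -/
def Equimeasurable [MeasurableSpace Ω] (P : Measure Ω) (ℓ : U → Ω → ℝ) : Prop :=
  ∀ ε : ℝ, 0 < ε → ∃ S : Set Ω, MeasurableSet S ∧ 1 - ε ≤ P.real S ∧
    ∃ hS : ∀ u : U, MemLp (S.indicator (ℓ u)) ∞ P,
      TotallyBounded (Set.range fun u : U => (hS u).toLp (S.indicator (ℓ u)))

/-- Pointwise separability of the loss: off one null set (not depending on the decision), every
`ℓ(u, ·)` is the pointwise limit of a sequence of functions `ℓ(v, ·)` with `v` in a fixed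
countable set. -/
def PointwiseSeparable [MeasurableSpace Ω] (P : Measure Ω) (ℓ : U → Ω → ℝ) : Prop :=
  ∃ U₀ : Set U, U₀.Countable ∧ ∃ Ω₀ : Set Ω, (∀ᵐ ω ∂P, ω ∈ Ω₀) ∧
    ∀ u : U, ∃ v : ℕ → U, (∀ n, v n ∈ U₀) ∧
      ∀ ω ∈ Ω₀, Tendsto (fun n => ℓ (v n) ω) atTop (𝓝 (ℓ u ω))

end PathwiseDecision

end

/-! Write `Z = 𝒴_{-∞,0}`. Condition on the infinite past `𝒴_{-∞,k} = T^{-k} Z` instead of `𝒴_{0,k}`.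
For an admissible `u` and a mean-optimal selection `w`, the difference `ℓ_k(u_k) - ℓ_k(w_k)` is the
centred loss of `u_k`, minus the centred loss of `w_k`, minus the conditional regret `E[ℓ_k(w_k) |
𝒴_{-∞,k}] - E[ℓ_k(u_k) | 𝒴_{-∞,k}]`. It suffices that the averages of the centred losses and of the
positive part of the regret vanish, almost surely or in probability; `IsAvgMode` records the closure
properties that let both modes share one argument.

Decisions are random and change with time, so uniformity over `U` is needed. Equimeasurability gives
finite nets of decisions, and separability a single exceptional null set; the error is then at most
`g ∘ T^k` with `∫ g` small, whatever the decision (`exists_uniform_approx`). The maximal ergodic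
inequality makes such stationary errors negligible in the averages.

The regret given `𝒴_{0,k}` is at most `1/k`. By stationarity `E[f ∘ T^k | 𝒴_{0,k}] = E[f | 𝒴_{-k,0}]
∘ T^k`, and Lévy's theorem sends `E[f | 𝒴_{-k,0}]` to `E[f | Z]`; Maker's ergodic theorem then shows
that passing to the infinite past costs nothing on average (`null_regret`). The centred losses
reduce to `1_{B_k} (f - E[f | Z]) ∘ T^k` with `B_k ∈ 𝒴_{-∞,k}`, which is `CenteredAverages`, and
only here does mixing enter.

In the K case, take `f` bounded and measurable at a finite level of the filtration `T^{-j} 𝒳`, and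
telescope `f - E[f | Z]` along `Z ∨ T^{-j} 𝒳`. Each increment, composed with `T^k` and cut by `B_k`,
is a bounded orthogonal sequence and obeys a strong law; the tail is `L¹`-small by reverse
martingale convergence. In the weak mixing case, take `f = 1_A`: the correlation at times `k < l` is
at most the mean conditional covariance at lag `l - k`, so the mean square of the average tends to
zero. -/

noncomputable section

namespace PathwiseDecision

variable {Ω : Type*} {U : Type*}

/-! ### Cesàro averages and modes of convergence -/

/-- The `N`-th Cesàro average `N⁻¹ ∑_{k=1}^N a_k` of a sequence of functions. -/
def avg (a : ℕ → Ω → ℝ) (N : ℕ) (ω : Ω) : ℝ := (1 / (N : ℝ)) * ∑ k ∈ Finset.Icc 1 N, a k ω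

lemma avg_sub (a b : ℕ → Ω → ℝ) (N : ℕ) (ω : Ω) :
    avg (fun k ω => a k ω - b k ω) N ω = avg a N ω - avg b N ω := by
  simp only [avg, Finset.sum_sub_distrib, mul_sub]

lemma avg_mono {a b : ℕ → Ω → ℝ} {N : ℕ} {ω : Ω} (h : ∀ k, 1 ≤ k → a k ω ≤ b k ω) :
    avg a N ω ≤ avg b N ω :=
  mul_le_mul_of_nonneg_left
    (Finset.sum_le_sum fun k hk => h k (Finset.mem_Icc.1 hk).1) (by positivity)

lemma avg_nonneg {a : ℕ → Ω → ℝ} {N : ℕ} {ω : Ω} (h : ∀ k, 1 ≤ k → 0 ≤ a k ω) :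
    0 ≤ avg a N ω :=
  mul_nonneg (by positivity) (Finset.sum_nonneg fun k hk => h k (Finset.mem_Icc.1 hk).1)

lemma abs_avg_le (a : ℕ → Ω → ℝ) (N : ℕ) (ω : Ω) : |avg a N ω| ≤ avg (fun k ω => |a k ω|) N ω := by
  rw [avg, avg, abs_mul, abs_of_nonneg (by positivity : (0 : ℝ) ≤ 1 / (N : ℝ))]
  exact mul_le_mul_of_nonneg_left (Finset.abs_sum_le_sum_abs _ _) (by positivity)

lemma abs_avg_sub_le {a b g : ℕ → Ω → ℝ} {ω : Ω} (h : ∀ k, 1 ≤ k → |a k ω - b k ω| ≤ g k ω)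
    (N : ℕ) : |avg a N ω - avg b N ω| ≤ avg g N ω := by
  rw [← avg_sub]
  exact (abs_avg_le _ _ _).trans (avg_mono h)

lemma tendsto_avg_of_tendsto {a : ℕ → Ω → ℝ} {ω : Ω} (h : Tendsto (fun k => a k ω) atTop (𝓝 0)) :
    Tendsto (fun N => avg a N ω) atTop (𝓝 0) := by
  have h1 : Tendsto (fun k => a (k + 1) ω) atTop (𝓝 0) := (tendsto_add_atTop_iff_nat 1).2 h
  refine h1.cesaro.congr fun N => ?_
  rw [avg, one_div, Finset.range_eq_Ico, Finset.sum_Ico_add' (fun k => a k ω) 0 N 1]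
  rfl

/-- `N⁻¹ ∑_{k ≤ N} a_k → 0` almost surely. -/
def AsNull {mΩ : MeasurableSpace Ω} (P : Measure Ω) (a : ℕ → Ω → ℝ) : Prop :=
  ∀ᵐ ω ∂P, Tendsto (fun N => avg a N ω) atTop (𝓝 0)

/-- `N⁻¹ ∑_{k ≤ N} a_k → 0` in probability. -/
def MeasNull {mΩ : MeasurableSpace Ω} (P : Measure Ω) (a : ℕ → Ω → ℝ) : Prop :=
  ∀ r : ℝ, 0 < r → Tendsto (fun N => P {ω | r ≤ |avg a N ω|}) atTop (𝓝 0)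

/-- A notion of convergence to zero of Cesàro averages that is implied by almost sure convergence
and stable under sums and under `L¹`-small stationary perturbations. -/
structure IsAvgMode {mΩ : MeasurableSpace Ω} (P : Measure Ω) (T : Equiv.Perm Ω)
    (Null : (ℕ → Ω → ℝ) → Prop) : Prop where
  of_as : ∀ a, (∀ k, 1 ≤ k → AEMeasurable (a k) P) → AsNull P a → Null a
  sub : ∀ a b, Null a → Null b → Null (fun k ω => a k ω - b k ω)
  approx : ∀ a, (∀ ε : ℝ, 0 < ε → ∃ (a' : ℕ → Ω → ℝ) (g : Ω → ℝ), Null a' ∧ Measurable g ∧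
    Integrable g P ∧ (∀ ω, 0 ≤ g ω) ∧ ∫ ω, g ω ∂P ≤ ε ∧
      ∀ k, 1 ≤ k → ∀ᵐ ω ∂P, |a k ω - a' k ω| ≤ g (iter T k ω)) → Null a

lemma IsAvgMode.add {mΩ : MeasurableSpace Ω} {P : Measure Ω} {T : Equiv.Perm Ω}
    {Null : (ℕ → Ω → ℝ) → Prop} (H : IsAvgMode P T Null) {a b : ℕ → Ω → ℝ} (ha : Null a)
    (hb : Null b) : Null (fun k ω => a k ω + b k ω) := by
  have h0 : Null (fun _ _ => 0) :=
    H.of_as _ (fun _ _ => aemeasurable_const) (Eventually.of_forall fun ω => by simp [avg])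
  have := H.sub _ _ ha (H.sub _ _ h0 hb)
  simpa using this

lemma IsAvgMode.sum {mΩ : MeasurableSpace Ω} {P : Measure Ω} {T : Equiv.Perm Ω}
    {Null : (ℕ → Ω → ℝ) → Prop} (H : IsAvgMode P T Null) {ι : Type*} (s : Finset ι)
    (a : ι → ℕ → Ω → ℝ) (ha : ∀ i ∈ s, Null (a i)) : Null (fun k ω => ∑ i ∈ s, a i k ω) := by
  classical
  induction s using Finset.induction_on with
  | empty =>
    simp only [Finset.sum_empty]
    exact H.of_as _ (fun _ _ => aemeasurable_const) (Eventually.of_forall fun ω => by simp [avg])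
  | insert i s hi ih =>
    simp only [Finset.sum_insert hi]
    exact H.add (ha i (Finset.mem_insert_self i s))
      (ih fun j hj => ha j (Finset.mem_insert_of_mem hj))

/-! ### Maximal ergodic inequality, closure under stationary errors, Maker's theorem -/

/-- The positive part of the running maxima of the partial sums of `h ∘ φ ^ i`. -/
def runMax (φ : Ω → Ω) (h : Ω → ℝ) : ℕ → Ω → ℝ
  | 0 => fun _ => 0
  | n + 1 => fun ω => max 0 (h ω + runMax φ h n (φ ω))

lemma runMax_nonneg (φ : Ω → Ω) (h : Ω → ℝ) (n : ℕ) (ω : Ω) : 0 ≤ runMax φ h n ω := by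
  cases n with
  | zero => exact le_rfl
  | succ n => exact le_max_left _ _

lemma runMax_le_succ (φ : Ω → Ω) (h : Ω → ℝ) (n : ℕ) (ω : Ω) :
    runMax φ h n ω ≤ runMax φ h (n + 1) ω := by
  induction n generalizing ω with
  | zero => exact le_max_left _ _
  | succ n ih => exact max_le_max le_rfl (by linarith [ih (φ ω)])

lemma measurable_runMax [MeasurableSpace Ω] {φ : Ω → Ω} (hφ : Measurable φ) {h : Ω → ℝ}
    (hh : Measurable h) (n : ℕ) : Measurable (runMax φ h n) := by
  induction n with
  | zero => exact measurable_const
  | succ n ih => exact measurable_const.max (hh.add (ih.comp hφ))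

lemma integrable_runMax [MeasurableSpace Ω] {P : Measure Ω} {φ : Ω → Ω}
    (hφ : MeasurePreserving φ P P) {h : Ω → ℝ} (hi : Integrable h P) (n : ℕ) :
    Integrable (runMax φ h n) P := by
  induction n with
  | zero => exact integrable_zero _ _ _
  | succ n ih =>
    exact (integrable_zero Ω ℝ P).sup (hi.add (hφ.integrable_comp_of_integrable ih))

/-- The maximal ergodic inequality. -/
lemma setIntegral_runMax_pos_nonneg [MeasurableSpace Ω] {P : Measure Ω} {φ : Ω → Ω}
    (hφ : MeasurePreserving φ P P) {h : Ω → ℝ} (hh : Measurable h) (hi : Integrable h P) (n : ℕ) :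
    0 ≤ ∫ ω in {ω | 0 < runMax φ h n ω}, h ω ∂P := by
  cases n with
  | zero => simp [runMax]
  | succ n =>
    set A := {ω | 0 < runMax φ h (n + 1) ω}
    have hA : MeasurableSet A := measurableSet_lt measurable_const (measurable_runMax hφ.measurable hh _)
    have hin := integrable_runMax hφ hi n
    have hin1 := integrable_runMax hφ hi (n + 1)
    have hinc : Integrable (fun ω => runMax φ h n (φ ω)) P := hφ.integrable_comp_of_integrable hin
    have hc : ∫ ω, runMax φ h n (φ ω) ∂P = ∫ ω, runMax φ h n ω ∂P := by
      have := integral_map (μ := P) hφ.measurable.aemeasurable (f := runMax φ h n)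
        (by rw [hφ.map_eq]; exact (measurable_runMax hφ.measurable hh n).aestronglyMeasurable)
      rw [hφ.map_eq] at this
      exact this.symm
    -- Garsia's argument. Where the `(n+1)`-st maximum is positive, `h` is that maximum minus the
    -- `n`-th one composed with `φ`. The former vanishes off `A`, the latter is nonnegative and
    -- keeps its integral under `φ`, and the maxima increase with `n`.
    have h1 : ∫ ω in A, h ω ∂P
        = ∫ ω in A, runMax φ h (n + 1) ω ∂P - ∫ ω in A, runMax φ h n (φ ω) ∂P := by
      rw [← integral_sub hin1.integrableOn hinc.integrableOn]
      refine setIntegral_congr_fun hA fun ω hω => ?_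
      have hω' : 0 < max 0 (h ω + runMax φ h n (φ ω)) := hω
      have : runMax φ h (n + 1) ω = h ω + runMax φ h n (φ ω) := by
        show max 0 (h ω + runMax φ h n (φ ω)) = _
        rcases lt_max_iff.1 hω' with h0 | h0
        · exact absurd h0 (lt_irrefl _)
        · exact max_eq_right h0.le
      simp only [this]; ring
    have h2 : ∫ ω in A, runMax φ h (n + 1) ω ∂P = ∫ ω, runMax φ h (n + 1) ω ∂P := by
      refine setIntegral_eq_integral_of_forall_compl_eq_zero fun ω hω => ?_
      exact le_antisymm (not_lt.1 hω) (runMax_nonneg _ _ _ _)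
    have h3 : ∫ ω in A, runMax φ h n (φ ω) ∂P ≤ ∫ ω, runMax φ h n (φ ω) ∂P :=
      setIntegral_le_integral hinc (Eventually.of_forall fun ω => runMax_nonneg _ _ _ _)
    have h4 : ∫ ω, runMax φ h n ω ∂P ≤ ∫ ω, runMax φ h (n + 1) ω ∂P :=
      integral_mono hin hin1 fun ω => runMax_le_succ _ _ _ _
    linarith

lemma iter_add (T : Equiv.Perm Ω) (j k : ℤ) (ω : Ω) : iter T (j + k) ω = iter T j (iter T k ω) := by
  simp [iter, zpow_add]

lemma iter_zero (T : Equiv.Perm Ω) (ω : Ω) : iter T 0 ω = ω := by simp [iter]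

/-- The averages start at `k = 1`, so the running maximum is built from `g ∘ T - r` rather than from
`g - r`. -/
lemma sum_iter_le_runMax (T : Equiv.Perm Ω) (g : Ω → ℝ) (r : ℝ) (n : ℕ) (ω : Ω) :
    ∑ k ∈ Finset.range n, (g (iter T ((k + 1 : ℕ) : ℤ) ω) - r)
      ≤ runMax (iter T 1) (fun ω => g (iter T 1 ω) - r) n ω := by
  induction n generalizing ω with
  | zero => simp [runMax]
  | succ n ih =>
    rw [Finset.sum_range_succ']
    refine le_trans ?_ (le_max_right _ _)
    have := ih (iter T 1 ω)
    simp only [← iter_add] at this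
    push_cast at this ⊢
    linarith

lemma avg_le_of_runMax (T : Equiv.Perm Ω) (g : Ω → ℝ) {r : ℝ} (n : ℕ) {ω : Ω}
    (h : ¬ 0 < runMax (iter T 1) (fun ω => g (iter T 1 ω) - r) n ω) (hr : 0 ≤ r) :
    avg (fun k ω => g (iter T k ω)) n ω ≤ r := by
  have h1 := (sum_iter_le_runMax T g r n ω).trans (not_lt.1 h)
  rw [Finset.sum_sub_distrib, Finset.sum_const, Finset.card_range, nsmul_eq_mul] at h1
  have h2 : ∑ k ∈ Finset.Icc 1 n, g (iter T k ω)
      = ∑ k ∈ Finset.range n, g (iter T ((k + 1 : ℕ) : ℤ) ω) := by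
    rw [Finset.range_eq_Ico, Finset.sum_Ico_add' (fun k : ℕ => g (iter T (k : ℤ) ω)) 0 n 1]
    rfl
  rw [avg, h2]
  rcases Nat.eq_zero_or_pos n with rfl | hn
  · simpa using hr
  · rw [one_div, inv_mul_le_iff₀ (by positivity)]
    linarith

/-- Weak type estimate for the maximal function of the ergodic averages. -/
lemma measure_exists_avg_gt_le [MeasurableSpace Ω] {P : Measure Ω} [IsProbabilityMeasure P]
    {T : Equiv.Perm Ω} (hT : ∀ k : ℤ, MeasurePreserving (iter T k) P P) {g : Ω → ℝ}
    (hgm : Measurable g) (hg : Integrable g P) (hg0 : ∀ ω, 0 ≤ g ω) {r : ℝ} (hr : 0 < r) :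
    P {ω | ∃ N : ℕ, r < avg (fun k ω => g (iter T k ω)) N ω}
      ≤ ENNReal.ofReal ((∫ ω, g ω ∂P) / r) := by
  set h : Ω → ℝ := fun ω => g (iter T 1 ω) - r with hh
  have hcm : Measurable (fun ω => g (iter T 1 ω)) := hgm.comp (hT 1).measurable
  have hci : Integrable (fun ω => g (iter T 1 ω)) P := (hT 1).integrable_comp_of_integrable hg
  have hhm : Measurable h := hcm.sub_const r
  have hhi : Integrable h P := hci.sub (integrable_const r)
  set A : ℕ → Set Ω := fun n => {ω | 0 < runMax (iter T 1) h n ω}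
  have hAm : ∀ n, MeasurableSet (A n) := fun n =>
    measurableSet_lt measurable_const (measurable_runMax (hT 1).measurable hhm n)
  have hmono : Monotone A := monotone_nat_of_le_succ fun n ω hω =>
    lt_of_lt_of_le hω (runMax_le_succ _ _ _ _)
  have hsub : {ω | ∃ N : ℕ, r < avg (fun k ω => g (iter T k ω)) N ω} ⊆ ⋃ n, A n := by
    rintro ω ⟨N, hN⟩
    refine Set.mem_iUnion.2 ⟨N, ?_⟩
    by_contra hc
    exact absurd (avg_le_of_runMax T g N hc hr.le) (not_le.2 hN)
  refine (measure_mono hsub).trans ?_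
  rw [hmono.measure_iUnion]
  refine iSup_le fun n => ?_
  have h1 := setIntegral_runMax_pos_nonneg (hT 1) hhm hhi n
  have h2 : ∫ ω in A n, h ω ∂P = ∫ ω in A n, g (iter T 1 ω) ∂P - r * P.real (A n) := by
    rw [hh, integral_sub hci.integrableOn (integrable_const r).integrableOn, setIntegral_const,
      smul_eq_mul, mul_comm]
  have h3 : ∫ ω in A n, g (iter T 1 ω) ∂P ≤ ∫ ω, g (iter T 1 ω) ∂P :=
    setIntegral_le_integral hci (Eventually.of_forall fun ω => hg0 _)
  have h4 : ∫ ω, g (iter T 1 ω) ∂P = ∫ ω, g ω ∂P := by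
    have := integral_map (μ := P) (hT 1).measurable.aemeasurable (f := g)
      (by rw [(hT 1).map_eq]; exact hgm.aestronglyMeasurable)
    rw [(hT 1).map_eq] at this
    exact this.symm
  have h5 : P.real (A n) ≤ (∫ ω, g ω ∂P) / r := by
    rw [le_div_iff₀ hr]
    have h1' : 0 ≤ ∫ ω in A n, h ω ∂P := h1
    linarith
  rw [← ofReal_measureReal (measure_ne_top P (A n))]
  exact ENNReal.ofReal_le_ofReal h5

/-- The difference of the averages is dominated by the ergodic average of `g`, so the weak type
estimate controls it for all `N` at once. This is what makes stationary `L¹`-small errors harmless.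
-/
lemma measure_avg_sub_gt_le [MeasurableSpace Ω] {P : Measure Ω} [IsProbabilityMeasure P]
    {T : Equiv.Perm Ω} (hT : ∀ k : ℤ, MeasurePreserving (iter T k) P P) {g : Ω → ℝ}
    (hgm : Measurable g) (hg : Integrable g P) (hg0 : ∀ ω, 0 ≤ g ω) {r : ℝ} (hr : 0 < r)
    {a b : ℕ → Ω → ℝ} (hab : ∀ k, 1 ≤ k → ∀ᵐ ω ∂P, |a k ω - b k ω| ≤ g (iter T k ω)) :
    P {ω | ∃ N : ℕ, r < |avg a N ω - avg b N ω|} ≤ ENNReal.ofReal ((∫ ω, g ω ∂P) / r) := by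
  refine le_trans (measure_mono_ae ?_) (measure_exists_avg_gt_le hT hgm hg hg0 hr)
  have : ∀ᵐ ω ∂P, ∀ k : ℕ, 1 ≤ k → |a k ω - b k ω| ≤ g (iter T k ω) :=
    ae_all_iff.2 fun k => by
      by_cases hk : 1 ≤ k
      · filter_upwards [hab k hk] with ω hω _ using hω
      · exact Eventually.of_forall fun ω h => absurd h hk
  filter_upwards [this] with ω hω
  rintro ⟨N, hN⟩
  exact ⟨N, hN.trans_le (abs_avg_sub_le (g := fun k ω => g (iter T k ω)) hω N)⟩

lemma eq_zero_of_forall_le_ofReal {x : ℝ≥0∞} (r : ℝ) (hr : 0 < r)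
    (h : ∀ ε : ℝ, 0 < ε → x ≤ ENNReal.ofReal (ε / r)) : x = 0 := by
  refine le_antisymm (ENNReal.le_of_forall_pos_le_add fun ε hε _ => ?_) (zero_le)
  have := h (ε * r) (by positivity)
  rw [mul_div_cancel_right₀ _ hr.ne', ENNReal.ofReal_coe_nnreal] at this
  simpa using this

lemma isAvgMode_asNull [MeasurableSpace Ω] {P : Measure Ω} [IsProbabilityMeasure P]
    {T : Equiv.Perm Ω} (hT : ∀ k : ℤ, MeasurePreserving (iter T k) P P) :
    IsAvgMode P T (AsNull P) where
  of_as _ _ h := h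
  sub a b ha hb := by
    filter_upwards [ha, hb] with ω h1 h2
    simpa [avg_sub] using h1.sub h2
  approx a h := by
    -- For fixed `r` the bad event lies, up to a null set, where the averages of `a` and `a'` differ
    -- by more than `r` for some `N`. Its probability is at most `ε / r` for every `ε`, hence zero.
    have key : ∀ r : ℝ, 0 < r → ∀ᵐ ω ∂P, ∀ᶠ N in atTop, |avg a N ω| ≤ 2 * r := by
      intro r hr
      rw [ae_iff]
      refine eq_zero_of_forall_le_ofReal r hr fun ε hε => ?_
      obtain ⟨a', g, ha', hgm, hgi, hg0, hgε, hag⟩ := h ε hε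
      refine le_trans (measure_mono_ae ?_) ((measure_avg_sub_gt_le hT hgm hgi hg0 hr hag).trans
        (ENNReal.ofReal_le_ofReal (div_le_div_of_nonneg_right hgε hr.le)))
      filter_upwards [ha'] with ω hω hbad
      by_contra hc
      refine hbad ?_
      have hc' : ∀ N, |avg a N ω - avg a' N ω| ≤ r := fun N => not_lt.1 fun hN => hc ⟨N, hN⟩
      filter_upwards [(tendsto_order.1 (by simpa using hω.abs)).2 r hr] with N hN
      have := abs_sub_abs_le_abs_sub (avg a N ω) (avg a' N ω)
      linarith [hc' N]
    have key2 : ∀ᵐ ω ∂P, ∀ n : ℕ, ∀ᶠ N in atTop, |avg a N ω| ≤ 2 * (1 / ((n : ℝ) + 1)) :=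
      ae_all_iff.2 fun n => key _ (by positivity)
    filter_upwards [key2] with ω hω
    rw [Metric.tendsto_atTop']
    intro ε hε
    obtain ⟨n, hn⟩ := exists_nat_one_div_lt (half_pos hε)
    obtain ⟨N, hN⟩ := eventually_atTop.1 (hω n)
    refine ⟨N, fun m hm => ?_⟩
    rw [Real.dist_eq, sub_zero]
    linarith [hN m hm.le]

lemma isAvgMode_measNull [MeasurableSpace Ω] {P : Measure Ω} [IsProbabilityMeasure P]
    {T : Equiv.Perm Ω} (hT : ∀ k : ℤ, MeasurePreserving (iter T k) P P) :
    IsAvgMode P T (MeasNull P) where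
  of_as a ha h := by
    have h1 : TendstoInMeasure P (fun N => avg a N) atTop (fun _ => 0) := by
      refine tendstoInMeasure_of_tendsto_ae (fun N => ?_) h
      refine AEMeasurable.aestronglyMeasurable ?_
      have : AEMeasurable (fun ω => ∑ k ∈ Finset.Icc 1 N, a k ω) P :=
        Finset.aemeasurable_fun_sum _ fun k hk => ha k (Finset.mem_Icc.1 hk).1
      exact this.const_mul _
    rw [tendstoInMeasure_iff_dist] at h1
    intro r hr
    simpa [Real.dist_eq] using h1 r hr
  sub a b ha hb r hr := by
    have h := (ha (r / 2) (half_pos hr)).add (hb (r / 2) (half_pos hr))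
    rw [add_zero] at h
    refine tendsto_of_tendsto_of_tendsto_of_le_of_le tendsto_const_nhds h (fun _ => zero_le)
      fun N => (measure_mono ?_).trans (measure_union_le _ _)
    intro ω hω
    have hω' : r ≤ |avg a N ω - avg b N ω| := by rw [← avg_sub]; exact hω
    by_contra hc
    simp only [Set.mem_union, Set.mem_ofPred_eq, not_or, not_le] at hc
    have := abs_sub (avg a N ω) (avg b N ω)
    linarith [hc.1, hc.2]
  approx a h r hr := by
    rw [ENNReal.tendsto_nhds_zero]
    intro δ hδ
    by_cases hδt : δ = ∞
    · exact Eventually.of_forall fun _ => by simp [hδt]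
    have hδ' : 0 < δ.toReal := ENNReal.toReal_pos hδ.ne' hδt
    -- With this bound on `∫ g`, the averages of `a` and `a'` ever differ by more than `r / 4` with
    -- probability at most `δ / 2`; the other `δ / 2` pays for the average of `a'` reaching `r / 2`.
    obtain ⟨a', g, ha', hgm, hgi, hg0, hgε, hag⟩ := h (δ.toReal / 2 * (r / 4)) (by positivity)
    have h1 := measure_avg_sub_gt_le hT hgm hgi hg0 (by positivity : 0 < r / 4) hag
    have h2 : ENNReal.ofReal ((∫ ω, g ω ∂P) / (r / 4)) ≤ δ / 2 := by
      refine ENNReal.ofReal_le_of_le_toReal ?_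
      rw [div_le_iff₀ (by positivity), ENNReal.toReal_div]
      simpa using hgε
    filter_upwards [ENNReal.tendsto_nhds_zero.1 (ha' (r / 2) (half_pos hr)) (δ / 2)
      (ENNReal.half_pos hδ.ne')] with N hN
    have h3 : P {ω | r ≤ |avg a N ω|} ≤ P {ω | r / 2 ≤ |avg a' N ω|}
        + P {ω | ∃ N : ℕ, r / 4 < |avg a N ω - avg a' N ω|} := by
      refine (measure_mono ?_).trans (measure_union_le _ _)
      intro ω hω
      by_contra hc
      simp only [Set.mem_union, Set.mem_ofPred_eq, not_or, not_le, not_exists, not_lt] at hc hω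
      have := abs_sub_abs_le_abs_sub (avg a N ω) (avg a' N ω)
      linarith [hc.1, hc.2 N]
    calc P {ω | r ≤ |avg a N ω|} ≤ _ := h3
      _ ≤ δ / 2 + δ / 2 := add_le_add hN (h1.trans h2)
      _ = δ := ENNReal.add_halves δ

/-- Stationary sequences dominated in `L¹` and tending to zero along the orbit have vanishing
averages (Maker). -/
lemma asNull_of_dominated [MeasurableSpace Ω] {P : Measure Ω} [IsProbabilityMeasure P]
    {T : Equiv.Perm Ω} (hT : ∀ k : ℤ, MeasurePreserving (iter T k) P P) {s : ℕ → Ω → ℝ}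
    (hsm : ∀ k, Measurable (s k)) {H : Ω → ℝ} (hH : Integrable H P)
    (hsH : ∀ k, ∀ᵐ ω ∂P, |s k ω| ≤ H ω)
    (hs0 : ∀ᵐ ω ∂P, Tendsto (fun k => s k ω) atTop (𝓝 0)) :
    AsNull P (fun k ω => s k (iter T k ω)) := by
  refine (isAvgMode_asNull hT).approx _ fun ε hε => ?_
  -- The tail suprema `sup_{k ≥ m} |s_k|` tend to zero almost surely and are dominated by `|H|`, so
  -- their integrals tend to zero. Taken in `ℝ≥0∞` they exist at every point.
  set W : ℕ → Ω → ℝ≥0∞ := fun m ω => ⨆ k, ⨆ _ : m ≤ k, ‖s k ω‖ₑ with hW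
  have hWm : ∀ m, Measurable (W m) := fun m =>
    Measurable.iSup fun k => Measurable.iSup fun _ => (hsm k).enorm
  have hWH : ∀ m, ∀ᵐ ω ∂P, W m ω ≤ ‖H ω‖ₑ := fun m => by
    filter_upwards [ae_all_iff.2 hsH] with ω hω
    refine iSup₂_le fun k _ => ?_
    rw [Real.enorm_eq_ofReal_abs, Real.enorm_eq_ofReal_abs]
    exact ENNReal.ofReal_le_ofReal ((hω k).trans (le_abs_self _))
  have hW0 : ∀ᵐ ω ∂P, Tendsto (fun m => W m ω) atTop (𝓝 0) := by
    filter_upwards [hs0] with ω hω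
    rw [ENNReal.tendsto_nhds_zero]
    intro δ hδ
    have h1 : Tendsto (fun k => ‖s k ω‖ₑ) atTop (𝓝 0) := by simpa using hω.enorm
    obtain ⟨m, hm⟩ := eventually_atTop.1 (ENNReal.tendsto_nhds_zero.1 h1 δ hδ)
    filter_upwards [eventually_ge_atTop m] with n hn
    exact iSup₂_le fun k hk => hm k (hn.trans hk)
  have hlim : Tendsto (fun m => ∫⁻ ω, W m ω ∂P) atTop (𝓝 0) := by
    have := tendsto_lintegral_of_dominated_convergence (μ := P) (fun ω => ‖H ω‖ₑ) hWm hWH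
      hH.hasFiniteIntegral.ne hW0
    simpa using this
  obtain ⟨m, hm⟩ := (ENNReal.tendsto_nhds_zero.1 hlim (ENNReal.ofReal ε)
    (ENNReal.ofReal_pos.2 hε)).exists
  have hfin : ∫⁻ ω, W m ω ∂P ≠ ∞ := (hm.trans_lt ENNReal.ofReal_lt_top).ne
  have hWt : ∀ᵐ ω ∂P, W m ω < ∞ := ae_lt_top (hWm m) hfin
  -- The first `m` terms have vanishing averages by themselves; every later term is at most the tail
  -- supremum at `T^k ω`.
  refine ⟨fun k ω => if k < m then s k (iter T k ω) else 0, fun ω => (W m ω).toReal, ?_,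
    (hWm m).ennreal_toReal, integrable_toReal_of_lintegral_ne_top (hWm m).aemeasurable hfin,
    fun _ => ENNReal.toReal_nonneg, ?_, fun k _ => ?_⟩
  · refine Eventually.of_forall fun ω => tendsto_avg_of_tendsto ?_
    refine tendsto_const_nhds.congr' ?_
    filter_upwards [eventually_ge_atTop m] with k hk
    rw [if_neg (not_lt.2 hk)]
  · rw [integral_toReal (hWm m).aemeasurable hWt]
    exact ENNReal.toReal_le_of_le_ofReal hε.le hm
  · have h1 : ∀ᵐ ω ∂P, W m (iter T k ω) < ∞ := (hT k).quasiMeasurePreserving.ae hWt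
    filter_upwards [h1] with ω hω
    split_ifs with hk
    · simp
    · rw [sub_zero, ← Real.norm_eq_abs, ← toReal_enorm]
      exact ENNReal.toReal_mono hω.ne (le_iSup₂_of_le k (not_lt.1 hk) le_rfl)

lemma measurePreserving_iter [MeasurableSpace Ω] {P : Measure Ω} (T : Ω ≃ᵐ Ω)
    (hT : MeasurePreserving T P P) (k : ℤ) : MeasurePreserving (iter T.toEquiv k) P P := by
  have hnat : ∀ n : ℕ, MeasurePreserving (iter T.toEquiv n) P P := by
    intro n
    induction n with
    | zero => exact MeasurePreserving.id P
    | succ n ih =>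
      have : iter T.toEquiv ((n + 1 : ℕ) : ℤ) = iter T.toEquiv n ∘ T := by
        funext ω
        push_cast
        rw [iter_add]
        simp [iter]
      rw [this]
      exact ih.comp hT
  have hsymm : MeasurePreserving T.symm P P := hT.symm T
  have hneg : ∀ n : ℕ, MeasurePreserving (iter T.toEquiv (-(n : ℤ))) P P := by
    intro n
    induction n with
    | zero => exact MeasurePreserving.id P
    | succ n ih =>
      have : iter T.toEquiv (-((n + 1 : ℕ) : ℤ)) = iter T.toEquiv (-(n : ℤ)) ∘ T.symm := by
        funext ω
        push_cast
        rw [neg_add, iter_add]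
        simp [iter]
      rw [this]
      exact ih.comp hsymm
  obtain ⟨n, rfl | rfl⟩ := k.eq_nat_or_neg
  · exact hnat n
  · exact hneg n

/-! ### Shifted σ-fields and conditional expectations along the orbit -/

lemma iter_comp (T : Equiv.Perm Ω) (j k : ℤ) : iter T j ∘ iter T k = iter T (j + k) := by
  funext ω
  exact (iter_add T j k ω).symm

lemma iter_neg_iter (T : Equiv.Perm Ω) (k : ℤ) (ω : Ω) : iter T (-k) (iter T k ω) = ω := by
  rw [← iter_add, neg_add_cancel, iter_zero]

lemma iter_iter_neg (T : Equiv.Perm Ω) (k : ℤ) (ω : Ω) : iter T k (iter T (-k) ω) = ω := by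
  rw [← iter_add, add_neg_cancel, iter_zero]

lemma pull_pull (T : Equiv.Perm Ω) (j k : ℤ) (m : MeasurableSpace Ω) :
    pull T j (pull T k m) = pull T (k + j) m := by
  rw [pull, pull, pull, MeasurableSpace.comap_comp, iter_comp]

lemma pull_mono (T : Equiv.Perm Ω) (k : ℤ) {m₁ m₂ : MeasurableSpace Ω} (h : m₁ ≤ m₂) :
    pull T k m₁ ≤ pull T k m₂ :=
  MeasurableSpace.comap_mono h

lemma pull_sup (T : Equiv.Perm Ω) (k : ℤ) (m₁ m₂ : MeasurableSpace Ω) :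
    pull T k (m₁ ⊔ m₂) = pull T k m₁ ⊔ pull T k m₂ :=
  MeasurableSpace.comap_sup

lemma obs_eq_pull (T : Equiv.Perm Ω) (Y : MeasurableSpace Ω) {I J : Set ℤ} {k : ℤ}
    (h : ∀ i, i ∈ I ↔ i + k ∈ J) : obs T Y J = pull T k (obs T Y I) := by
  have hp : pull T k (obs T Y I) = ⨆ i ∈ I, pull T (i + k) Y := by
    simp only [pull, obs, MeasurableSpace.comap_iSup, MeasurableSpace.comap_comp, iter_comp]
  rw [hp]
  refine le_antisymm (iSup₂_le fun j hj => ?_) (iSup₂_le fun i hi => ?_)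
  · have hj' : j - k ∈ I := (h _).2 (by simpa using hj)
    have := le_iSup₂ (f := fun i (_ : i ∈ I) => pull T (i + k) Y) (j - k) hj'
    simpa using this
  · exact le_iSup₂ (f := fun i (_ : i ∈ J) => pull T i Y) (i + k) ((h i).1 hi)

lemma obs_Iic_eq_pull (T : Equiv.Perm Ω) (Y : MeasurableSpace Ω) (k : ℤ) :
    obs T Y (Set.Iic k) = pull T k (obs T Y (Set.Iic 0)) :=
  obs_eq_pull T Y fun i => by simp

lemma obs_Icc_eq_pull (T : Equiv.Perm Ω) (Y : MeasurableSpace Ω) (k : ℤ) :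
    obs T Y (Set.Icc 0 k) = pull T k (obs T Y (Set.Icc (-k) 0)) :=
  obs_eq_pull T Y fun i => by simp only [Set.mem_Icc]; constructor <;> intro h <;> constructor <;> linarith

lemma obs_mono (T : Equiv.Perm Ω) (Y : MeasurableSpace Ω) {I J : Set ℤ} (h : I ⊆ J) :
    obs T Y I ≤ obs T Y J :=
  biSup_mono h

lemma pull_le {m : MeasurableSpace Ω} [mΩ : MeasurableSpace Ω] {P : Measure Ω} {T : Equiv.Perm Ω}
    (hT : ∀ k : ℤ, MeasurePreserving (iter T k) P P) (k : ℤ)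
    (hm : m ≤ mΩ) : pull T k m ≤ mΩ :=
  (MeasurableSpace.comap_mono hm).trans (hT k).measurable.comap_le

lemma obs_le {Y : MeasurableSpace Ω} [mΩ : MeasurableSpace Ω] {P : Measure Ω} {T : Equiv.Perm Ω}
    (hT : ∀ k : ℤ, MeasurePreserving (iter T k) P P) (hY : Y ≤ mΩ) (I : Set ℤ) :
    obs T Y I ≤ mΩ :=
  iSup₂_le fun k _ => pull_le hT k hY

lemma measurable_iter_pull (T : Equiv.Perm Ω) (k : ℤ) (m : MeasurableSpace Ω) :
    Measurable[pull T k m, m] (iter T k) :=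
  comap_measurable _

lemma iSup_obs_Icc (T : Equiv.Perm Ω) (Y : MeasurableSpace Ω) :
    ⨆ n : ℕ, obs T Y (Set.Icc (-(n : ℤ)) 0) = obs T Y (Set.Iic 0) := by
  refine le_antisymm (iSup_le fun n => obs_mono T Y fun i hi => hi.2) (iSup₂_le fun i hi => ?_)
  refine le_trans ?_ (le_iSup _ i.natAbs)
  have hi' : i ∈ Set.Icc (-(i.natAbs : ℤ)) 0 := by
    simp only [Set.mem_Iic] at hi
    exact ⟨by omega, hi⟩
  exact le_iSup₂ (f := fun j (_ : j ∈ Set.Icc (-(i.natAbs : ℤ)) 0) => pull T j Y) i hi'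

lemma integral_comp_iter [MeasurableSpace Ω] {P : Measure Ω} {φ : Ω → Ω}
    (hφ : MeasurePreserving φ P P) {f : Ω → ℝ} (hf : AEStronglyMeasurable f P) :
    ∫ ω, f (φ ω) ∂P = ∫ ω, f ω ∂P := by
  have := integral_map (μ := P) hφ.measurable.aemeasurable (f := f) (by rwa [hφ.map_eq])
  rw [hφ.map_eq] at this
  exact this.symm

/-- Sets of the comap are preimages `φ⁻¹ t` with `t` in `m`, so the defining integral identity for
`P[f | m]` on `t` is carried over by `φ`. -/
lemma condExp_comp_measurePreserving {m mΩ : MeasurableSpace Ω} {P : Measure Ω}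
    [IsProbabilityMeasure P] {φ : Ω → Ω} (hφ : MeasurePreserving φ P P)
    (hm : m ≤ mΩ) {f : Ω → ℝ} (hf : Integrable f P) :
    P[fun ω => f (φ ω) | m.comap φ] =ᵐ[P] fun ω => (P[f | m]) (φ ω) := by
  have hle : m.comap φ ≤ mΩ := (MeasurableSpace.comap_mono hm).trans hφ.measurable.comap_le
  refine (ae_eq_condExp_of_forall_setIntegral_eq hle (hφ.integrable_comp_of_integrable hf)
    (fun s _ _ => (hφ.integrable_comp_of_integrable integrable_condExp).integrableOn)
    ?_ ?_).symm
  · rintro s ⟨t, ht, rfl⟩ -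
    have h1 : ∀ g : Ω → ℝ, Integrable g P → ∫ ω in φ ⁻¹' t, g (φ ω) ∂P = ∫ ω in t, g ω ∂P := by
      intro g hg
      rw [← integral_indicator (hφ.measurable (hm t ht)), ← integral_indicator (hm t ht),
        ← integral_comp_iter hφ (hg.indicator (hm t ht)).aestronglyMeasurable]
      rfl
    refine (h1 _ integrable_condExp).trans (Eq.trans ?_ (h1 _ hf).symm)
    rw [setIntegral_condExp hm hf ht]
  · have : StronglyMeasurable[m.comap φ] (fun ω => (P[f | m]) (φ ω)) :=
      (stronglyMeasurable_condExp (μ := P) (f := f) (m := m)).comp_measurable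
        (comap_measurable φ)
    exact this.aestronglyMeasurable

lemma condExp_pull {m mΩ : MeasurableSpace Ω} {P : Measure Ω} [IsProbabilityMeasure P]
    {T : Equiv.Perm Ω} (hT : ∀ k : ℤ, MeasurePreserving (iter T k) P P)
    (hm : m ≤ mΩ) {f : Ω → ℝ} (hf : Integrable f P) (k : ℤ) :
    P[fun ω => f (iter T k ω) | pull T k m] =ᵐ[P] fun ω => (P[f | m]) (iter T k ω) :=
  condExp_comp_measurePreserving (hT k) hm hf

/-- Lévy's upward theorem along `𝒴_{-n,0} ↑ 𝒴_{-∞,0}`. Shifted by `T^k`, it compares what is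
observed since time `0` with the infinite past. -/
lemma tendsto_condExp_obs {Y : MeasurableSpace Ω} [mΩ : MeasurableSpace Ω] {P : Measure Ω}
    [IsProbabilityMeasure P] {T : Equiv.Perm Ω}
    (hT : ∀ k : ℤ, MeasurePreserving (iter T k) P P) (hY : Y ≤ mΩ) (f : Ω → ℝ) :
    ∀ᵐ ω ∂P, Tendsto (fun n : ℕ => (P[f | obs T Y (Set.Icc (-(n : ℤ)) 0)]) ω) atTop
      (𝓝 ((P[f | obs T Y (Set.Iic 0)]) ω)) := by
  let ℱ : Filtration ℕ mΩ :=
    { seq := fun n => obs T Y (Set.Icc (-(n : ℤ)) 0)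
      mono' := fun i j hij => obs_mono T Y (Set.Icc_subset_Icc (by simpa using hij) le_rfl)
      le' := fun n => obs_le hT hY _ }
  have := tendsto_ae_condExp (μ := P) (ℱ := ℱ) f
  have hsup : ⨆ n, ℱ n = obs T Y (Set.Iic 0) := iSup_obs_Icc T Y
  rw [hsup] at this
  exact this

/-! ### Uniform approximation by finitely many decisions -/

lemma exists_setIntegral_small [MeasurableSpace Ω] {P : Measure Ω} {f : Ω → ℝ}
    (hf : Integrable f P) (hf0 : ∀ ω, 0 ≤ f ω) {ε : ℝ} (hε : 0 < ε) :
    ∃ δ : ℝ, 0 < δ ∧ ∀ s : Set Ω, MeasurableSet s → P s ≤ ENNReal.ofReal δ →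
      ∫ ω in s, f ω ∂P ≤ ε := by
  obtain ⟨δ, hδ, h⟩ := exists_pos_setLIntegral_lt_of_measure_lt (μ := P)
    (f := fun ω => ENNReal.ofReal (f ω)) hf.lintegral_lt_top.ne
    (ENNReal.ofReal_pos.2 hε).ne'
  refine ⟨(min δ 1 / 2).toReal, ENNReal.toReal_pos ?_ ?_, fun s _ hPs => ?_⟩
  · simp [hδ.ne']
  · exact ENNReal.div_ne_top (min_lt_of_right_lt ENNReal.one_lt_top).ne (by norm_num)
  · have hm : min δ 1 ≠ ∞ := (min_lt_of_right_lt ENNReal.one_lt_top).ne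
    rw [ENNReal.ofReal_toReal (ENNReal.div_ne_top hm (by norm_num))] at hPs
    have h1 : P s < δ := hPs.trans_lt ((ENNReal.half_lt_self
      (by simp [hδ.ne']) hm).trans_le (min_le_left _ _))
    rw [integral_eq_lintegral_of_nonneg_ae (Eventually.of_forall hf0) hf.1.restrict]
    exact ENNReal.toReal_le_of_le_ofReal hε.le (h s h1).le

lemma ae_le_of_dist_toLp_lt [MeasurableSpace Ω] {P : Measure Ω} {f g : Ω → ℝ}
    (hf : MemLp f ∞ P) (hg : MemLp g ∞ P) {δ : ℝ} (h : dist (hf.toLp f) (hg.toLp g) < δ) :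
    ∀ᵐ ω ∂P, |f ω - g ω| ≤ δ := by
  rw [dist_eq_norm, ← MemLp.toLp_sub hf hg, Lp.norm_toLp, eLpNorm_exponent_top] at h
  have hfin : eLpNormEssSup (f - g) P ≠ ∞ := by
    rw [← eLpNorm_exponent_top]; exact (hf.sub hg).2.ne
  filter_upwards [ae_le_eLpNormEssSup (f := f - g) (μ := P)] with ω hω
  have h1 := ENNReal.toReal_mono hfin hω
  rw [toReal_enorm, Real.norm_eq_abs] at h1
  exact h1.trans h.le

/-- A finite set of decisions that is `δ`-dense, uniformly on the set `S`. -/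
lemma exists_finite_net [MeasurableSpace Ω] [Nonempty U] {P : Measure Ω} {ℓ : U → Ω → ℝ}
    {S : Set Ω} (hS : ∀ u : U, MemLp (S.indicator (ℓ u)) ∞ P)
    (htb : TotallyBounded (Set.range fun u : U => (hS u).toLp (S.indicator (ℓ u))))
    {δ : ℝ} (hδ : 0 < δ) :
    ∃ (n : ℕ) (c : ℕ → U), ∀ u, ∃ j < n, ∀ᵐ ω ∂P, ω ∈ S → |ℓ u ω - ℓ (c j) ω| ≤ δ := by
  obtain ⟨t, htr, htf, hcov⟩ := Metric.finite_approx_of_totallyBounded htb δ hδ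
  choose! f hf using fun y (hy : y ∈ t) => htr hy
  set l : List (Lp ℝ ∞ P) := htf.toFinset.toList with hl
  -- Indices past the end of the list read the default `0` and give an irrelevant decision; only `j
  -- < l.length` is used.
  refine ⟨l.length, fun j => f (l.getD j 0), fun u => ?_⟩
  have hu := hcov (Set.mem_range_self u)
  simp only [Set.mem_iUnion, Metric.mem_ball] at hu
  obtain ⟨y, hyt, hy⟩ := hu
  obtain ⟨j, hj, hjy⟩ := List.mem_iff_getElem.1
    (show y ∈ l by rw [hl, Finset.mem_toList]; exact htf.mem_toFinset.2 hyt)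
  refine ⟨j, hj, ?_⟩
  have hget : l.getD j 0 = y := by rw [List.getD_eq_getElem _ _ hj, hjy]
  simp only [hget]
  rw [← hf y hyt] at hy
  filter_upwards [ae_le_of_dist_toLp_lt _ _ hy] with ω hω hωS
  simpa [Set.indicator_of_mem hωS] using hω

/-- By joint measurability the measure of a section depends measurably on `u`. Hence the least index
of a net point close to `u` is a measurable function of `u`, without any topology on `U`. -/
lemma measurableSet_measure_dev_eq_zero [MeasurableSpace Ω] [MeasurableSpace U] {P : Measure Ω}
    [IsProbabilityMeasure P] {ℓ : U → Ω → ℝ} (hℓ : Measurable (Function.uncurry ℓ)) {S : Set Ω}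
    (hS : MeasurableSet S) (δ : ℝ) (c : U) :
    MeasurableSet {u : U | P {ω | ω ∈ S ∧ δ < |ℓ u ω - ℓ c ω|} = 0} := by
  have hc : Measurable fun p : U × Ω => ℓ c p.2 :=
    hℓ.comp (measurable_const.prodMk measurable_snd)
  have hM : MeasurableSet {p : U × Ω | p.2 ∈ S ∧ δ < |ℓ p.1 p.2 - ℓ c p.2|} :=
    (measurable_snd hS).inter (measurableSet_lt measurable_const
      (_root_.measurable_abs.comp (hℓ.sub hc)))
  exact measurable_measure_prodMk_left hM (measurableSet_singleton 0)

lemma measure_dev_eq_zero_iff [MeasurableSpace Ω] {P : Measure Ω} {f g : Ω → ℝ} {S : Set Ω}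
    {δ : ℝ} : P {ω | ω ∈ S ∧ δ < |f ω - g ω|} = 0 ↔ ∀ᵐ ω ∂P, ω ∈ S → |f ω - g ω| ≤ δ := by
  rw [ae_iff]
  simp only [Classical.not_imp, not_le]

/-- Equimeasurability and pointwise separability make the loss uniformly approximable by finitely
many decisions, chosen measurably, up to a stationary `L¹`-small error. -/
lemma exists_uniform_approx [MeasurableSpace Ω] [MeasurableSpace U] [Nonempty U]
    {P : Measure Ω} [IsProbabilityMeasure P] {ℓ : U → Ω → ℝ}
    (hℓ : Measurable (Function.uncurry ℓ)) {Λ : Ω → ℝ} (hΛ : Integrable Λ P)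
    (hdom : ∀ u ω, |ℓ u ω| ≤ Λ ω) (hequi : Equimeasurable P ℓ) (hsep : PointwiseSeparable P ℓ)
    {ε : ℝ} (hε : 0 < ε) :
    ∃ (n : ℕ) (c : ℕ → U) (J : U → ℕ) (g : Ω → ℝ), Measurable J ∧ (∀ u, J u < n) ∧
      Measurable g ∧ Integrable g P ∧ (∀ ω, 0 ≤ g ω) ∧ ∫ ω, g ω ∂P ≤ ε ∧
      ∀ᵐ ω ∂P, ∀ u, |ℓ u ω - ℓ (c (J u)) ω| ≤ g ω := by
  classical
  -- A measurable version of `2|Λ|`, which bounds the difference of any two losses; it serves as the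
  -- error off `S`.
  set L : Ω → ℝ := fun ω => 2 * |hΛ.1.mk Λ ω| with hL
  have hLm : Measurable L :=
    (_root_.measurable_abs.comp hΛ.1.stronglyMeasurable_mk.measurable).const_mul 2
  have hLi : Integrable L P := ((hΛ.congr hΛ.1.ae_eq_mk).abs).const_mul 2
  have hL0 : ∀ ω, 0 ≤ L ω := fun ω => by positivity
  obtain ⟨η, hη, hsmall⟩ := exists_setIntegral_small hLi hL0 (half_pos hε)
  obtain ⟨S, hS, hPS, hSmem, htb⟩ := hequi η hη
  -- Of `3δ`, one `δ` comes from a limit along `U₀` and `2δ` from comparing two net points. The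
  -- other `ε / 2` is the integral of `L` off `S`.
  obtain ⟨δ, hδ, hδε⟩ : ∃ δ : ℝ, 0 < δ ∧ 3 * δ = ε / 2 := ⟨ε / 6, by positivity, by ring⟩
  obtain ⟨n, c, hnet⟩ := exists_finite_net hSmem htb hδ
  have hex : ∀ u, ∃ j, P {ω | ω ∈ S ∧ δ < |ℓ u ω - ℓ (c j) ω|} = 0 := fun u => by
    obtain ⟨j, -, hj⟩ := hnet u
    exact ⟨j, measure_dev_eq_zero_iff.2 hj⟩
  -- The null set off which `c (J u)` is close to `u` still depends on `u`. The next steps replace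
  -- it by a single one.
  set J : U → ℕ := fun u => Nat.find (hex u) with hJ
  have hJm : Measurable J :=
    measurable_find hex fun k => measurableSet_measure_dev_eq_zero hℓ hS δ (c k)
  have hJlt : ∀ u, J u < n := fun u => by
    obtain ⟨j, hjn, hj⟩ := hnet u
    exact (Nat.find_min' (hex u) (measure_dev_eq_zero_iff.2 hj)).trans_lt hjn
  have hJae : ∀ u, ∀ᵐ ω ∂P, ω ∈ S → |ℓ u ω - ℓ (c (J u)) ω| ≤ δ := fun u =>
    measure_dev_eq_zero_iff.1 (Nat.find_spec (hex u))
  obtain ⟨U₀, hU₀, Ω₀, hΩ₀, hlim⟩ := hsep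
  have hU₀ae : ∀ᵐ ω ∂P, ∀ v ∈ U₀, ω ∈ S → |ℓ v ω - ℓ (c (J v)) ω| ≤ δ :=
    (ae_ball_iff hU₀).2 fun v _ => hJae v
  -- Along a sequence in `U₀` converging to `u`, the index takes one of its finitely many values `j`
  -- infinitely often. The bound by `δ` for `c j` passes to the limit at every `ω` outside a null
  -- set attached to the countable `U₀`.
  have hgood : ∀ u, ∃ j, ∀ ω, ω ∈ Ω₀ → (∀ v ∈ U₀, ω ∈ S → |ℓ v ω - ℓ (c (J v)) ω| ≤ δ) →
      ω ∈ S → |ℓ u ω - ℓ (c j) ω| ≤ δ := by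
    intro u
    obtain ⟨v, hv, hvlim⟩ := hlim u
    obtain ⟨j, hj⟩ : ∃ j, ∃ᶠ k in atTop, J (v k) = j := by
      by_contra hc
      push Not at hc
      have h1 : ∀ᶠ k in (atTop : Filter ℕ), ∀ j ∈ Finset.range n, J (v k) ≠ j :=
        (Finset.range n).eventually_all.2 fun j _ => by simpa using hc j
      obtain ⟨k, hk⟩ := h1.exists
      exact hk _ (Finset.mem_range.2 (hJlt (v k))) rfl
    refine ⟨j, fun ω hω hall hωS => ?_⟩
    refine le_of_tendsto_of_frequently ((hvlim ω hω).sub_const (ℓ (c j) ω)).abs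
      (hj.mono fun k hk => ?_)
    rw [← hk]
    exact hall (v k) (hv k) hωS
  -- The index `j` found above may differ from `J u`. Both net points are `δ`-close to `u`, hence
  -- `2δ`-close to each other almost everywhere on `S`; there are only countably many pairs of
  -- indices, so one null set serves all.
  have hpairs : ∀ᵐ ω ∂P, ∀ i j : ℕ, (∀ᵐ ω' ∂P, ω' ∈ S → |ℓ (c i) ω' - ℓ (c j) ω'| ≤ 2 * δ) →
      ω ∈ S → |ℓ (c i) ω - ℓ (c j) ω| ≤ 2 * δ := by
    refine ae_all_iff.2 fun i => ae_all_iff.2 fun j => ?_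
    by_cases h : ∀ᵐ ω' ∂P, ω' ∈ S → |ℓ (c i) ω' - ℓ (c j) ω'| ≤ 2 * δ
    · filter_upwards [h] with ω hω _ using hω
    · exact Eventually.of_forall fun ω h' => absurd h' h
  refine ⟨n, c, J, fun ω => 3 * δ + Sᶜ.indicator L ω, hJm, hJlt,
    measurable_const.add (hLm.indicator hS.compl),
    (integrable_const _).add (hLi.indicator hS.compl), fun ω => ?_, ?_, ?_⟩
  · have : 0 ≤ Sᶜ.indicator L ω := Set.indicator_nonneg (fun ω _ => hL0 ω) ω
    positivity
  · rw [integral_add (integrable_const _) (hLi.indicator hS.compl), integral_const,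
      integral_indicator hS.compl, probReal_univ, one_smul, hδε]
    have h1 : P Sᶜ ≤ ENNReal.ofReal η := by
      rw [← ofReal_measureReal (measure_ne_top P Sᶜ), probReal_compl_eq_one_sub hS]
      exact ENNReal.ofReal_le_ofReal (by linarith)
    linarith [hsmall Sᶜ hS.compl h1]
  · filter_upwards [hΩ₀, hU₀ae, hpairs, hΛ.1.ae_eq_mk] with ω h0 hU hp hΛω u
    by_cases hωS : ω ∈ S
    · obtain ⟨j, hj⟩ := hgood u
      have h2 : ∀ᵐ ω' ∂P, ω' ∈ S → |ℓ (c j) ω' - ℓ (c (J u)) ω'| ≤ 2 * δ := by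
        filter_upwards [hΩ₀, hU₀ae, hJae u] with ω' h0' hU' hJ' hS'
        have h3 := hj ω' h0' hU' hS'
        have h4 := hJ' hS'
        rw [abs_le] at h3 h4 ⊢
        constructor <;> linarith [h3.1, h3.2, h4.1, h4.2]
      have h5 := hp _ _ h2 hωS
      have h6 := hj ω h0 hU hωS
      rw [Set.indicator_of_notMem (by simpa using hωS), add_zero]
      rw [abs_le] at h5 h6 ⊢
      constructor <;> linarith [h5.1, h5.2, h6.1, h6.2]
    · rw [Set.indicator_of_mem (by simpa using hωS)]
      have h7 : L ω = 2 * |Λ ω| := by rw [hL, hΛω]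
      have h8 := abs_sub (ℓ u ω) (ℓ (c (J u)) ω)
      linarith [hdom u ω, hdom (c (J u)) ω, le_abs_self (Λ ω)]

/-! ### Existence of mean-optimal selections -/

lemma measurable_lossAt [MeasurableSpace Ω] [MeasurableSpace U] {P : Measure Ω}
    {T : Equiv.Perm Ω} (hT : ∀ k : ℤ, MeasurePreserving (iter T k) P P) {ℓ : U → Ω → ℝ}
    (hℓ : Measurable (Function.uncurry ℓ)) (k : ℕ) {v : Ω → U} (hv : Measurable v) :
    Measurable (lossAt T ℓ k v) :=
  hℓ.comp (hv.prodMk (hT k).measurable)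

lemma integrable_lossAt [MeasurableSpace Ω] [MeasurableSpace U] {P : Measure Ω}
    {T : Equiv.Perm Ω} (hT : ∀ k : ℤ, MeasurePreserving (iter T k) P P) {ℓ : U → Ω → ℝ}
    (hℓ : Measurable (Function.uncurry ℓ)) {Λ : Ω → ℝ} (hΛ : Integrable Λ P)
    (hdom : ∀ u ω, |ℓ u ω| ≤ Λ ω) (k : ℕ) {v : Ω → U} (hv : Measurable v) :
    Integrable (lossAt T ℓ k v) P :=
  ((hT k).integrable_comp_of_integrable hΛ).mono'
    (measurable_lossAt hT hℓ k hv).aestronglyMeasurable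
    (Eventually.of_forall fun ω => hdom (v ω) _)

/-- Conditional expectation of the loss of a decision with countably many values. -/
lemma condExp_lossAt_comp {m : MeasurableSpace Ω} [mΩ : MeasurableSpace Ω] [MeasurableSpace U]
    {P : Measure Ω} [IsProbabilityMeasure P]
    {T : Equiv.Perm Ω} (hT : ∀ k : ℤ, MeasurePreserving (iter T k) P P) {ℓ : U → Ω → ℝ}
    (hℓ : Measurable (Function.uncurry ℓ)) {Λ : Ω → ℝ} (hΛ : Integrable Λ P)
    (hdom : ∀ u ω, |ℓ u ω| ≤ Λ ω) (k : ℕ) (hm : m ≤ mΩ) (c : ℕ → U) {N : Ω → ℕ}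
    (hN : Measurable[m] N) :
    ∀ᵐ ω ∂P, (P[lossAt T ℓ k (fun ω => c (N ω)) | m]) ω
      = (P[lossAt T ℓ k (fun _ => c (N ω)) | m]) ω := by
  have hNm : Measurable N := hN.mono hm le_rfl
  have h1 := integrable_lossAt hT hℓ hΛ hdom k (measurable_from_nat (f := c) |>.comp hNm)
  have h2 := fun n => integrable_lossAt hT hℓ hΛ hdom k
    (v := fun _ : Ω => c n) measurable_const
  have key : ∀ n, ∀ᵐ ω ∂P, N ω = n → (P[lossAt T ℓ k (fun ω => c (N ω)) | m]) ω
      = (P[lossAt T ℓ k (fun _ => c n) | m]) ω := by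
    intro n
    have hs : MeasurableSet[m] (N ⁻¹' {n}) := hN (measurableSet_singleton n)
    have h3 := condExp_indicator h1 hs
    have h4 := condExp_indicator (h2 n) hs
    have h5 : (N ⁻¹' {n}).indicator (lossAt T ℓ k (c ∘ N))
        = (N ⁻¹' {n}).indicator (lossAt T ℓ k (fun _ => c n)) := by
      refine Set.indicator_congr fun ω hω => ?_
      have : N ω = n := hω
      simp [lossAt, this]
    rw [h5] at h3
    filter_upwards [h3, h4] with ω h6 h7 hω
    have hmem : ω ∈ N ⁻¹' {n} := hω
    rw [h6, Set.indicator_of_mem hmem, Set.indicator_of_mem hmem] at h7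
    exact h7
  filter_upwards [ae_all_iff.2 key] with ω hω
  exact hω _ rfl

lemma exists_measurable_approx_argmin {m : MeasurableSpace Ω} {φ : ℕ → Ω → ℝ}
    (hφ : ∀ p, Measurable (φ p)) {δ : ℝ} (hδ : 0 < δ) :
    ∃ N : Ω → ℕ, Measurable N ∧ ∀ ω, φ (N ω) ω < (⨅ p, φ p ω) + δ := by
  classical
  have hex : ∀ ω, ∃ p, φ p ω < (⨅ p, φ p ω) + δ := fun ω =>
    exists_lt_of_ciInf_lt (lt_add_of_pos_right _ hδ)
  exact ⟨fun ω => Nat.find (hex ω), measurable_find hex fun p =>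
    measurableSet_lt (hφ p) ((Measurable.iInf hφ).add_const δ), fun ω => Nat.find_spec (hex ω)⟩

/-- The positive part of `f - g` has integral at most every `ε > 0`, hence vanishes almost
everywhere. -/
lemma ae_le_of_forall_sub_le [MeasurableSpace Ω] {P : Measure Ω} {f g : Ω → ℝ}
    (hf : AEMeasurable f P) (hg : AEMeasurable g P)
    (h : ∀ ε : ℝ, 0 < ε → ∃ q : Ω → ℝ, Integrable q P ∧ (∀ᵐ ω ∂P, 0 ≤ q ω) ∧
      ∫ ω, q ω ∂P ≤ ε ∧ ∀ᵐ ω ∂P, f ω - g ω ≤ q ω) : f ≤ᵐ[P] g := by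
  have h0 : ∫⁻ ω, ENNReal.ofReal (f ω - g ω) ∂P = 0 := by
    refine eq_zero_of_forall_le_ofReal 1 one_pos fun ε hε => ?_
    obtain ⟨q, hq, hq0, hqε, hle⟩ := h ε hε
    rw [div_one]
    refine le_trans (lintegral_mono_ae (hle.mono fun ω hω => ENNReal.ofReal_le_ofReal hω)) ?_
    rw [← ofReal_integral_eq_lintegral_ofReal hq hq0]
    exact ENNReal.ofReal_le_ofReal hqε
  have hm : AEMeasurable (fun ω => ENNReal.ofReal (f ω - g ω)) P := (hf.sub hg).ennreal_ofReal
  rw [lintegral_eq_zero_iff' hm] at h0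
  filter_upwards [h0] with ω hω
  simpa using hω

/-- Rounding the decision to the net costs at most `g ∘ T^k` pointwise. The rounded decision takes
countably many values, so its conditional loss is found by freezing its value. -/
lemma condExp_comp_le_add {m : MeasurableSpace Ω} [mΩ : MeasurableSpace Ω] [MeasurableSpace U]
    {P : Measure Ω} [IsProbabilityMeasure P]
    {T : Equiv.Perm Ω} (hT : ∀ k : ℤ, MeasurePreserving (iter T k) P P) {ℓ : U → Ω → ℝ}
    (hℓ : Measurable (Function.uncurry ℓ)) {Λ : Ω → ℝ} (hΛ : Integrable Λ P)
    (hdom : ∀ u ω, |ℓ u ω| ≤ Λ ω) (k : ℕ) {c : ℕ → U} {J : U → ℕ} {g : Ω → ℝ}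
    (hJ : Measurable J) (hg : Integrable g P)
    (happ : ∀ᵐ ω ∂P, ∀ u, |ℓ u ω - ℓ (c (J u)) ω| ≤ g ω) (hm : m ≤ mΩ) {v : Ω → U}
    (hv : Measurable[m] v) :
    ∀ᵐ ω ∂P, |(P[lossAt T ℓ k v | m]) ω - (P[lossAt T ℓ k (fun _ => c (J (v ω))) | m]) ω|
      ≤ (P[fun ω => g (iter T k ω) | m]) ω := by
  have hvm : Measurable v := hv.mono hm le_rfl
  have hJv : Measurable[m] (fun ω => J (v ω)) := hJ.comp hv
  have hgi : Integrable (fun ω => g (iter T k ω)) P := (hT k).integrable_comp_of_integrable hg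
  have h1 := integrable_lossAt hT hℓ hΛ hdom k hvm
  have h2 : Integrable (lossAt T ℓ k fun ω => c (J (v ω))) P :=
    integrable_lossAt hT hℓ hΛ hdom k (measurable_from_nat (f := c) |>.comp (hJ.comp hvm))
  have h3 := (hT k).quasiMeasurePreserving.ae happ
  have h4 : ∀ᵐ ω ∂P, |lossAt T ℓ k v ω - lossAt T ℓ k (fun ω => c (J (v ω))) ω|
      ≤ g (iter T k ω) := by
    filter_upwards [h3] with ω hω using hω (v ω)
  have h5 : |lossAt T ℓ k v - lossAt T ℓ k fun ω => c (J (v ω))| ≤ᵐ[P]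
      fun ω => g (iter T k ω) := h4
  filter_upwards [condExp_lossAt_comp hT hℓ hΛ hdom k hm c hJv, condExp_sub h1 h2 m,
    abs_condExp_ae_le_condExp_abs (m := m) (μ := P)
      (lossAt T ℓ k v - lossAt T ℓ k fun ω => c (J (v ω))),
    condExp_mono (m := m) (h1.sub h2).abs hgi h5] with ω h6 h7 h8 h9
  rw [← h6]
  rw [Pi.abs_apply, h7] at h8
  exact h8.trans h9

/-- The essential infimum is already the infimum over a countable family of constant decisions, the
union of nets of accuracy `1/(i+1)`: the conditional loss of any `v` exceeds one of theirs up to an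
error with small integral. The least index coming within `δ` of that infimum is `m`-measurable. -/
lemma exists_approx_minimizer {m : MeasurableSpace Ω} [mΩ : MeasurableSpace Ω]
    [MeasurableSpace U] [Nonempty U]
    {P : Measure Ω} [IsProbabilityMeasure P]
    {T : Equiv.Perm Ω} (hT : ∀ k : ℤ, MeasurePreserving (iter T k) P P) {ℓ : U → Ω → ℝ}
    (hℓ : Measurable (Function.uncurry ℓ)) {Λ : Ω → ℝ} (hΛ : Integrable Λ P)
    (hdom : ∀ u ω, |ℓ u ω| ≤ Λ ω) (hequi : Equimeasurable P ℓ) (hsep : PointwiseSeparable P ℓ)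
    (hm : m ≤ mΩ) (k : ℕ) {δ : ℝ} (hδ : 0 < δ) :
    ∃ v : Ω → U, Measurable[m] v ∧ ∃ g : Ω → ℝ,
      IsEssInf P {f | ∃ v : Ω → U, Measurable[m] v ∧ f = P[lossAt T ℓ k v | m]} g ∧
      ∀ᵐ ω ∂P, (P[lossAt T ℓ k v | m]) ω ≤ g ω + δ := by
  choose n c J q hJ hJn hqm hqi hq0 hqε happ using fun i : ℕ =>
    exists_uniform_approx hℓ hΛ hdom hequi hsep (ε := 1 / ((i : ℝ) + 1)) (by positivity)
  set D : ℕ → U := fun p => c p.unpair.1 p.unpair.2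
  set B : Ω → ℝ := P[fun ω => Λ (iter T k ω) | m] with hB
  set φ : ℕ → Ω → ℝ := fun p => P[lossAt T ℓ k (fun _ => D p) | m]
  -- Cutting off at `-B` changes each `φ p` only on a null set and makes the family bounded below at
  -- every `ω`, as the real infimum requires.
  set ψ : ℕ → Ω → ℝ := fun p ω => max (φ p ω) (-B ω)
  have hBm : Measurable[m] B := stronglyMeasurable_condExp.measurable
  have hφm : ∀ p, Measurable[m] (φ p) := fun p => stronglyMeasurable_condExp.measurable
  have hψm : ∀ p, Measurable[m] (ψ p) := fun p => (hφm p).max hBm.neg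
  have hbdd : ∀ ω, BddBelow (Set.range fun p => ψ p ω) := fun ω =>
    ⟨-B ω, by rintro _ ⟨p, rfl⟩; exact le_max_right _ _⟩
  have hΛk : Integrable (fun ω => Λ (iter T k ω)) P := (hT k).integrable_comp_of_integrable hΛ
  have hφψ : ∀ᵐ ω ∂P, ∀ p, ψ p ω = φ p ω := by
    refine ae_all_iff.2 fun p => ?_
    have h1 := integrable_lossAt hT hℓ hΛ hdom k
      (v := fun _ : Ω => D p) measurable_const
    have h2 : |lossAt T ℓ k fun _ => D p| ≤ᵐ[P] fun ω => Λ (iter T k ω) :=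
      Eventually.of_forall fun ω => hdom _ _
    filter_upwards [abs_condExp_ae_le_condExp_abs (m := m) (μ := P) (lossAt T ℓ k fun _ => D p),
      condExp_mono (m := m) h1.abs hΛk h2] with ω h3 h4
    exact max_eq_left (neg_le_of_abs_le (h3.trans h4))
  obtain ⟨N, hN, hNlt⟩ := exists_measurable_approx_argmin hψm hδ
  have hgm : Measurable[m] (fun ω => ⨅ p, ψ p ω) := Measurable.iInf hψm
  refine ⟨fun ω => D (N ω), (measurable_from_nat (f := D)).comp hN, fun ω => ⨅ p, ψ p ω,
    ⟨hgm.mono hm le_rfl, ?_, ?_⟩, ?_⟩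
  · rintro _ ⟨v, hv, rfl⟩
    refine ae_le_of_forall_sub_le (hgm.mono hm le_rfl).aemeasurable
      integrable_condExp.1.aemeasurable fun ε hε => ?_
    obtain ⟨i, hi⟩ := exists_nat_one_div_lt hε
    refine ⟨P[fun ω => q i (iter T k ω) | m], integrable_condExp,
      condExp_nonneg (Eventually.of_forall fun ω => hq0 i _), ?_, ?_⟩
    · rw [integral_condExp hm, integral_comp_iter (hT k) (hqi i).1]
      exact (hqε i).trans hi.le
    · filter_upwards [condExp_comp_le_add hT hℓ hΛ hdom k (hJ i) (hqi i) (happ i) hm hv, hφψ]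
        with ω h1 h2
      have h3 : φ (Nat.pair i (J i (v ω))) ω
          = (P[lossAt T ℓ k (fun _ => c i (J i (v ω))) | m]) ω := by
        simp only [φ, D, Nat.unpair_pair]
      have h4 := ciInf_le (hbdd ω) (Nat.pair i (J i (v ω)))
      rw [h2, h3] at h4
      rw [abs_le] at h1
      linarith [h1.1]
  · intro h _ hle
    have h1 : ∀ p, h ≤ᵐ[P] φ p := fun p => hle _ ⟨fun _ => D p, measurable_const, rfl⟩
    filter_upwards [ae_all_iff.2 h1] with ω hω
    exact le_ciInf fun p => (hω p).trans (le_max_left _ _)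
  · filter_upwards [condExp_lossAt_comp hT hℓ hΛ hdom k hm D hN, hφψ] with ω h1 h2
    rw [h1]
    have := hNlt ω
    rw [h2] at this
    exact this.le

theorem exists_isMeanOptimalSelection (Y : MeasurableSpace Ω) [mΩ : MeasurableSpace Ω]
    (hY : Y ≤ mΩ) [MeasurableSpace U] [Nonempty U]
    {P : Measure Ω} [IsProbabilityMeasure P]
    {T : Equiv.Perm Ω} (hT : ∀ k : ℤ, MeasurePreserving (iter T k) P P) {ℓ : U → Ω → ℝ}
    (hℓ : Measurable (Function.uncurry ℓ)) {Λ : Ω → ℝ} (hΛ : Integrable Λ P)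
    (hdom : ∀ u ω, |ℓ u ω| ≤ Λ ω) (hequi : Equimeasurable P ℓ) (hsep : PointwiseSeparable P ℓ) :
    ∃ u : ℕ → Ω → U, IsMeanOptimalSelection Y P T ℓ u := by
  have h : ∀ k : ℕ, 1 ≤ k → _ := fun k hk =>
    exists_approx_minimizer hT hℓ hΛ hdom hequi hsep
      (obs_le hT hY (Set.Icc 0 (k : ℤ))) k (δ := 1 / (k : ℝ))
      (by have : (0 : ℝ) < k := Nat.cast_pos.2 hk
          positivity)
  choose! u hu g hg using h
  exact ⟨u, hu, fun k hk => ⟨g k, hg k hk⟩⟩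

/-! ### Reduction of optimality to centred averages -/

/-- Along every sequence of events `B_k ∈ 𝒴_{-∞,k}` the averages of the stationary sequence
`f ∘ T^k`, centred at its conditional expectation given `𝒴_{-∞,k}`, vanish. -/
def CenteredAverages (Y : MeasurableSpace Ω) {mΩ : MeasurableSpace Ω} (P : Measure Ω)
    (T : Equiv.Perm Ω) (Null : (ℕ → Ω → ℝ) → Prop) (f : Ω → ℝ) : Prop :=
  ∀ B : ℕ → Set Ω, (∀ k : ℕ, 1 ≤ k → MeasurableSet[obs T Y (Set.Iic (k : ℤ))] (B k)) →
    Null fun k => (B k).indicator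
      fun ω => f (iter T k ω) - (P[f | obs T Y (Set.Iic 0)]) (iter T k ω)

lemma integrable_loss [MeasurableSpace Ω] [MeasurableSpace U] {P : Measure Ω}
    {ℓ : U → Ω → ℝ} {Λ : Ω → ℝ} (hℓ : Measurable (Function.uncurry ℓ)) (hΛ : Integrable Λ P)
    (hdom : ∀ u ω, |ℓ u ω| ≤ Λ ω) (u : U) : Integrable (ℓ u) P :=
  hΛ.mono' (hℓ.comp (measurable_const.prodMk measurable_id)).aestronglyMeasurable
    (Eventually.of_forall fun ω => hdom u ω)

lemma sum_indicator_fiber (N : Ω → ℕ) (n : ℕ) (F : ℕ → Ω → ℝ) {ω : Ω} (h : N ω < n) :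
    ∑ j ∈ Finset.range n, (N ⁻¹' {j}).indicator (F j) ω = F (N ω) ω := by
  rw [Finset.sum_eq_single_of_mem (N ω) (Finset.mem_range.2 h)]
  · exact Set.indicator_of_mem (s := N ⁻¹' {N ω}) rfl (F (N ω))
  · intro j _ hj
    exact Set.indicator_of_notMem (s := N ⁻¹' {j}) (fun h => hj (show N ω = j from h).symm) _

section Reduction

variable {Y : MeasurableSpace Ω} [mΩ : MeasurableSpace Ω] [MeasurableSpace U] {P : Measure Ω}
  [IsProbabilityMeasure P] {T : Equiv.Perm Ω} {ℓ : U → Ω → ℝ} {Λ : Ω → ℝ}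
  {Null : (ℕ → Ω → ℝ) → Prop}

lemma condExp_loss_const (hT : ∀ k : ℤ, MeasurePreserving (iter T k) P P) (hY : Y ≤ mΩ)
    {f : Ω → ℝ} (hf : Integrable f P) (k : ℕ) :
    P[fun ω => f (iter T k ω) | obs T Y (Set.Iic (k : ℤ))]
      =ᵐ[P] fun ω => (P[f | obs T Y (Set.Iic 0)]) (iter T k ω) := by
  rw [obs_Iic_eq_pull]
  exact condExp_pull hT (obs_le hT hY _) hf k

lemma condExp_loss_const_Icc (hT : ∀ k : ℤ, MeasurePreserving (iter T k) P P) (hY : Y ≤ mΩ)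
    {f : Ω → ℝ} (hf : Integrable f P) (k : ℕ) :
    P[fun ω => f (iter T k ω) | obs T Y (Set.Icc 0 (k : ℤ))]
      =ᵐ[P] fun ω => (P[f | obs T Y (Set.Icc (-(k : ℤ)) 0)]) (iter T k ω) := by
  rw [obs_Icc_eq_pull]
  exact condExp_pull hT (obs_le hT hY _) hf k

/-- The rounded decision is constant on the fibres of `J ∘ v_k`, which lie in `𝒴_{-∞,k}`; its
centred loss is therefore a finite sum of terms covered by `CenteredAverages`. Rounding costs `g +
|E[g | Z]|` at `T^k ω`, whose integral is at most `2 ∫ g`. -/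
lemma null_loss_sub_condExp (hT : ∀ k : ℤ, MeasurePreserving (iter T k) P P) (hY : Y ≤ mΩ)
    (H : IsAvgMode P T Null) [Nonempty U]
    (hcore : ∀ f, Measurable f → Integrable f P → CenteredAverages Y P T Null f)
    (hℓ : Measurable (Function.uncurry ℓ)) (hΛ : Integrable Λ P)
    (hdom : ∀ u ω, |ℓ u ω| ≤ Λ ω) (hequi : Equimeasurable P ℓ) (hsep : PointwiseSeparable P ℓ)
    {v : ℕ → Ω → U} (hv : ∀ k : ℕ, 1 ≤ k → Measurable[obs T Y (Set.Iic (k : ℤ))] (v k)) :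
    Null fun k ω => lossAt T ℓ k (v k) ω
      - (P[lossAt T ℓ k (v k) | obs T Y (Set.Iic (k : ℤ))]) ω := by
  refine H.approx _ fun ε hε => ?_
  obtain ⟨n, c, J, g, hJ, hJn, hgm, hgi, hg0, hgε, happ⟩ :=
    exists_uniform_approx hℓ hΛ hdom hequi hsep (half_pos hε)
  set G : Ω → ℝ := P[g | obs T Y (Set.Iic 0)] with hG
  have hZ : obs T Y (Set.Iic 0) ≤ mΩ := obs_le hT hY _
  have hGm : Measurable G := (stronglyMeasurable_condExp.mono hZ).measurable
  have hfi := integrable_loss hℓ hΛ hdom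
  set F : ℕ → ℕ → Ω → ℝ := fun k j ω =>
    ℓ (c j) (iter T k ω) - (P[ℓ (c j) | obs T Y (Set.Iic 0)]) (iter T k ω)
  refine ⟨fun k ω => ∑ j ∈ Finset.range n, ((fun ω => J (v k ω)) ⁻¹' {j}).indicator (F k j) ω,
    fun ω => g ω + |G ω|, ?_, hgm.add (_root_.measurable_abs.comp hGm),
    hgi.add integrable_condExp.abs,
    fun ω => add_nonneg (hg0 ω) (abs_nonneg _), ?_, fun k hk => ?_⟩
  · refine H.sum _ (fun j k => ((fun ω => J (v k ω)) ⁻¹' {j}).indicator (F k j)) fun j _ => ?_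
    exact hcore _ (hℓ.comp (measurable_const.prodMk measurable_id)) (hfi (c j)) _
      fun k hk => (hJ.comp (hv k hk)) (measurableSet_singleton j)
  · rw [integral_add hgi integrable_condExp.abs]
    have h1 := integral_abs_condExp_le (μ := P) (m := obs T Y (Set.Iic 0)) g
    have h2 : ∫ ω, |g ω| ∂P = ∫ ω, g ω ∂P := by simp only [abs_of_nonneg (hg0 _)]
    linarith
  · have h1 := condExp_comp_le_add hT hℓ hΛ hdom k hJ hgi happ
      (obs_le hT hY (Set.Iic (k : ℤ))) (hv k hk)
    have h2 : ∀ᵐ ω ∂P, ∀ j, (P[lossAt T ℓ k (fun _ => c j) | obs T Y (Set.Iic (k : ℤ))]) ω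
        = (P[ℓ (c j) | obs T Y (Set.Iic 0)]) (iter T k ω) :=
      ae_all_iff.2 fun j => condExp_loss_const hT hY (hfi (c j)) k
    have h3 := (hT k).quasiMeasurePreserving.ae happ
    filter_upwards [h1, h2, h3, condExp_loss_const hT hY hgi k] with ω k1 k2 k3 k4
    rw [sum_indicator_fiber (fun ω => J (v k ω)) n (F k) (hJn _)]
    rw [k4, k2] at k1
    have k5 : |lossAt T ℓ k (v k) ω - ℓ (c (J (v k ω))) (iter T k ω)| ≤ g (iter T k ω) :=
      k3 (v k ω)
    have k6 := le_abs_self (G (iter T k ω))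
    simp only [F]
    rw [abs_le] at k1 k5 ⊢
    constructor <;> linarith [k1.1, k1.2, k5.1, k5.2]

/-- After rounding, only the fixed functions `ℓ (c j)` are compared, and the shift by `T^k` turns
the two σ-fields into `𝒴_{-k,0}` and `Z`. Each conditional expectation contributes one rounding
error; the one given the finite past is rewritten through `E[g | Z]`, whence the factor `2` and the
extra difference. -/
lemma abs_condExp_Iic_sub_Icc_le (hT : ∀ k : ℤ, MeasurePreserving (iter T k) P P) (hY : Y ≤ mΩ)
    (hℓ : Measurable (Function.uncurry ℓ)) (hΛ : Integrable Λ P)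
    (hdom : ∀ u ω, |ℓ u ω| ≤ Λ ω) {n : ℕ} {c : ℕ → U} {J : U → ℕ} {g : Ω → ℝ}
    (hJ : Measurable J) (hJn : ∀ u, J u < n) (hg : Integrable g P)
    (happ : ∀ᵐ ω ∂P, ∀ u, |ℓ u ω - ℓ (c (J u)) ω| ≤ g ω) (k : ℕ) {v : Ω → U}
    (hv : Measurable[obs T Y (Set.Icc 0 (k : ℤ))] v) :
    ∀ᵐ ω ∂P, |(P[lossAt T ℓ k v | obs T Y (Set.Iic (k : ℤ))]) ω
        - (P[lossAt T ℓ k v | obs T Y (Set.Icc 0 (k : ℤ))]) ω|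
      ≤ (∑ j ∈ Finset.range n, |(P[ℓ (c j) | obs T Y (Set.Icc (-(k : ℤ)) 0)]) (iter T k ω)
          - (P[ℓ (c j) | obs T Y (Set.Iic 0)]) (iter T k ω)|)
        + |(P[g | obs T Y (Set.Icc (-(k : ℤ)) 0)]) (iter T k ω)
          - (P[g | obs T Y (Set.Iic 0)]) (iter T k ω)|
        + 2 * (P[g | obs T Y (Set.Iic 0)]) (iter T k ω) := by
  have hfi := integrable_loss hℓ hΛ hdom
  have hv' : Measurable[obs T Y (Set.Iic (k : ℤ))] v :=
    hv.mono (obs_mono T Y Set.Icc_subset_Iic_self) le_rfl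
  have h1 := condExp_comp_le_add hT hℓ hΛ hdom k hJ hg happ (obs_le hT hY (Set.Iic (k : ℤ))) hv'
  have h1' := condExp_comp_le_add hT hℓ hΛ hdom k hJ hg happ
    (obs_le hT hY (Set.Icc 0 (k : ℤ))) hv
  have h2 : ∀ᵐ ω ∂P, ∀ j, (P[lossAt T ℓ k (fun _ => c j) | obs T Y (Set.Iic (k : ℤ))]) ω
      = (P[ℓ (c j) | obs T Y (Set.Iic 0)]) (iter T k ω) :=
    ae_all_iff.2 fun j => condExp_loss_const hT hY (hfi (c j)) k
  have h2' : ∀ᵐ ω ∂P, ∀ j, (P[lossAt T ℓ k (fun _ => c j) | obs T Y (Set.Icc 0 (k : ℤ))]) ω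
      = (P[ℓ (c j) | obs T Y (Set.Icc (-(k : ℤ)) 0)]) (iter T k ω) :=
    ae_all_iff.2 fun j => condExp_loss_const_Icc hT hY (hfi (c j)) k
  filter_upwards [h1, h1', h2, h2', condExp_loss_const hT hY hg k,
    condExp_loss_const_Icc hT hY hg k] with ω k1 k1' k2 k2' k3 k3'
  rw [k2, k3] at k1
  rw [k2', k3'] at k1'
  have k4 := Finset.single_le_sum (s := Finset.range n)
    (f := fun j => |(P[ℓ (c j) | obs T Y (Set.Icc (-(k : ℤ)) 0)]) (iter T k ω)
          - (P[ℓ (c j) | obs T Y (Set.Iic 0)]) (iter T k ω)|) (fun j _ => abs_nonneg _)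
    (Finset.mem_range.2 (hJn (v ω)))
  have k5 := le_abs_self ((P[g | obs T Y (Set.Icc (-(k : ℤ)) 0)]) (iter T k ω)
          - (P[g | obs T Y (Set.Iic 0)]) (iter T k ω))
  have k6 := abs_le.1 (le_refl |(P[ℓ (c (J (v ω))) | obs T Y (Set.Icc (-(k : ℤ)) 0)]) (iter T k ω)
          - (P[ℓ (c (J (v ω))) | obs T Y (Set.Iic 0)]) (iter T k ω)|)
  rw [abs_le] at k1 k1' ⊢
  constructor <;> linarith [k1.1, k1.2, k1'.1, k1'.2, k6.1, k6.2]

lemma abs_condExp_lossAt_le (hT : ∀ k : ℤ, MeasurePreserving (iter T k) P P) (hY : Y ≤ mΩ)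
    (hℓ : Measurable (Function.uncurry ℓ)) (hΛ : Integrable Λ P)
    (hdom : ∀ u ω, |ℓ u ω| ≤ Λ ω) (k : ℕ) {v : Ω → U} (hv : Measurable v) :
    ∀ᵐ ω ∂P, |(P[lossAt T ℓ k v | obs T Y (Set.Iic (k : ℤ))]) ω|
      ≤ (P[Λ | obs T Y (Set.Iic 0)]) (iter T k ω) := by
  have h2 : |lossAt T ℓ k v| ≤ᵐ[P] fun ω => Λ (iter T k ω) :=
    Eventually.of_forall fun ω => hdom _ _
  filter_upwards [abs_condExp_ae_le_condExp_abs (m := obs T Y (Set.Iic (k : ℤ))) (μ := P)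
    (lossAt T ℓ k v), condExp_mono (m := obs T Y (Set.Iic (k : ℤ)))
      (integrable_lossAt hT hℓ hΛ hdom k hv).abs ((hT k).integrable_comp_of_integrable hΛ) h2,
    condExp_loss_const hT hY hΛ k] with ω h3 h4 h5
  rw [← h5]
  exact h3.trans h4

/-- The asymptotic regret of a mean-optimal selection given the infinite past vanishes. -/
lemma null_regret (hT : ∀ k : ℤ, MeasurePreserving (iter T k) P P) (hY : Y ≤ mΩ)
    (H : IsAvgMode P T Null) [Nonempty U]
    (hℓ : Measurable (Function.uncurry ℓ)) (hΛ : Integrable Λ P)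
    (hdom : ∀ u ω, |ℓ u ω| ≤ Λ ω) (hequi : Equimeasurable P ℓ) (hsep : PointwiseSeparable P ℓ)
    {u w : ℕ → Ω → U} (hu : Admissible T Y u) (hw : Admissible T Y w)
    (hopt : ∀ k : ℕ, 1 ≤ k → ∀ᵐ ω ∂P,
      (P[lossAt T ℓ k (w k) | obs T Y (Set.Icc 0 (k : ℤ))]) ω
        ≤ (P[lossAt T ℓ k (u k) | obs T Y (Set.Icc 0 (k : ℤ))]) ω + 1 / (k : ℝ)) :
    Null fun k ω => max 0 ((P[lossAt T ℓ k (w k) | obs T Y (Set.Iic (k : ℤ))]) ω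
      - (P[lossAt T ℓ k (u k) | obs T Y (Set.Iic (k : ℤ))]) ω) := by
  refine H.approx _ fun ε hε => ?_
  set e : ℕ → Ω → ℝ := fun k ω => max 0 ((P[lossAt T ℓ k (w k) | obs T Y (Set.Iic (k : ℤ))]) ω
      - (P[lossAt T ℓ k (u k) | obs T Y (Set.Iic (k : ℤ))]) ω) with he
  have hem : ∀ k, Measurable (e k) := fun k => measurable_const.max
    ((stronglyMeasurable_condExp.mono (obs_le hT hY _)).measurable.sub
      (stronglyMeasurable_condExp.mono (obs_le hT hY _)).measurable)
  -- The final error is `4|E[g | Z]|`: two copies for `u` and two for `w`.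
  obtain ⟨n, c, J, g, hJ, hJn, hgm, hgi, hg0, hgε, happ⟩ :=
    exists_uniform_approx hℓ hΛ hdom hequi hsep (show 0 < ε / 4 by positivity)
  have hfi := integrable_loss hℓ hΛ hdom
  -- The `1/k` slack of the selection plus the cost of the change of σ-field, paid once for `u` and
  -- once for `w`.
  set ρ : ℕ → Ω → ℝ := fun k ω => 1 / (k : ℝ)
    + 2 * ((∑ j ∈ Finset.range n, |(P[ℓ (c j) | obs T Y (Set.Icc (-(k : ℤ)) 0)]) ω
          - (P[ℓ (c j) | obs T Y (Set.Iic 0)]) ω|)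
        + |(P[g | obs T Y (Set.Icc (-(k : ℤ)) 0)]) ω - (P[g | obs T Y (Set.Iic 0)]) ω|) with hρ
  have hcm : ∀ (f : Ω → ℝ) (I : Set ℤ), Measurable (P[f | obs T Y I]) := fun f I =>
    (stronglyMeasurable_condExp.mono (obs_le hT hY I)).measurable
  have hρm : ∀ k, Measurable (ρ k) := fun k => by
    refine measurable_const.add (Measurable.const_mul (Measurable.add ?_ ?_) 2)
    · exact Finset.measurable_fun_sum _ fun j _ =>
        _root_.measurable_abs.comp ((hcm _ _).sub (hcm _ _))
    · exact _root_.measurable_abs.comp ((hcm _ _).sub (hcm _ _))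
  have hρ0 : ∀ k ω, 0 ≤ ρ k ω := fun k ω => by
    simp only [hρ]
    positivity
  have hρlim : ∀ᵐ ω ∂P, Tendsto (fun k => ρ k ω) atTop (𝓝 0) := by
    have h1 : ∀ᵐ ω ∂P, ∀ j, Tendsto (fun k : ℕ =>
        (P[ℓ (c j) | obs T Y (Set.Icc (-(k : ℤ)) 0)]) ω) atTop (𝓝 ((P[ℓ (c j) | obs T Y (Set.Iic 0)]) ω)) :=
      ae_all_iff.2 fun j => tendsto_condExp_obs hT hY _
    filter_upwards [h1, tendsto_condExp_obs hT hY g] with ω h2 h3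
    have h4 : Tendsto (fun k : ℕ => ∑ j ∈ Finset.range n,
        |(P[ℓ (c j) | obs T Y (Set.Icc (-(k : ℤ)) 0)]) ω - (P[ℓ (c j) | obs T Y (Set.Iic 0)]) ω|) atTop
        (𝓝 (∑ j ∈ Finset.range n, 0)) := by
      refine tendsto_finsetSum _ fun j _ => ?_
      simpa using ((h2 j).sub_const ((P[ℓ (c j) | obs T Y (Set.Iic 0)]) ω)).abs
    have h5 : Tendsto (fun k : ℕ =>
        |(P[g | obs T Y (Set.Icc (-(k : ℤ)) 0)]) ω - (P[g | obs T Y (Set.Iic 0)]) ω|) atTop (𝓝 0) := by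
      simpa using (h3.sub_const ((P[g | obs T Y (Set.Iic 0)]) ω)).abs
    have h6 := (tendsto_one_div_atTop_nhds_zero_nat (𝕜 := ℝ)).add ((h4.add h5).const_mul 2)
    simp only [Finset.sum_const_zero, add_zero, mul_zero] at h6
    exact h6
  set L : Ω → ℝ := fun ω => 2 * |(P[Λ | obs T Y (Set.Iic 0)]) ω| with hL
  have hLm : Measurable L := (_root_.measurable_abs.comp (hcm Λ _)).const_mul 2
  have hLi : Integrable L P := integrable_condExp.abs.const_mul 2
  -- Almost surely `ρ k` tends to zero, but no integrable majorant is at hand. The regret is also at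
  -- most `L ∘ T^k`, so the smaller bound may be used and Maker's theorem applies.
  set s : ℕ → Ω → ℝ := fun k ω => min (ρ k ω) (L ω) with hs
  have hsm : ∀ k, Measurable (s k) := fun k => (hρm k).min hLm
  have hs0 : ∀ k ω, 0 ≤ s k ω := fun k ω => le_min (hρ0 k ω) (by simp only [hL]; positivity)
  have hsnull : AsNull P fun k ω => s k (iter T k ω) := by
    refine asNull_of_dominated hT hsm hLi (fun k => Eventually.of_forall fun ω => ?_) ?_
    · rw [abs_of_nonneg (hs0 k ω)]
      exact min_le_right _ _
    · filter_upwards [hρlim] with ω hω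
      exact squeeze_zero (fun k => hs0 k ω) (fun k => min_le_left _ _) hω
  refine ⟨fun k ω => min (e k ω) (s k (iter T k ω)), fun ω => 4 * |(P[g | obs T Y (Set.Iic 0)]) ω|,
    H.of_as _ (fun k _ => ((hem k).min ((hsm k).comp (hT k).measurable)).aemeasurable) ?_,
    (_root_.measurable_abs.comp (hcm g _)).const_mul 4, integrable_condExp.abs.const_mul 4,
    fun ω => by positivity, ?_, fun k hk => ?_⟩
  · filter_upwards [hsnull] with ω hω
    exact squeeze_zero (fun N => avg_nonneg fun k _ => le_min (le_max_left _ _) (hs0 _ _))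
      (fun N => avg_mono fun k _ => min_le_right _ _) hω
  · rw [integral_const_mul]
    have h1 := integral_abs_condExp_le (μ := P) (m := obs T Y (Set.Iic 0)) g
    have h2 : ∫ ω, |g ω| ∂P = ∫ ω, g ω ∂P := by simp only [abs_of_nonneg (hg0 _)]
    linarith
  · have hum : Measurable (u k) := (hu k hk).mono (obs_le hT hY _) le_rfl
    have hwm : Measurable (w k) := (hw k hk).mono (obs_le hT hY _) le_rfl
    filter_upwards [abs_condExp_Iic_sub_Icc_le hT hY hℓ hΛ hdom hJ hJn hgi happ k (hu k hk),
      abs_condExp_Iic_sub_Icc_le hT hY hℓ hΛ hdom hJ hJn hgi happ k (hw k hk),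
      abs_condExp_lossAt_le hT hY hℓ hΛ hdom k hum, abs_condExp_lossAt_le hT hY hℓ hΛ hdom k hwm,
      hopt k hk] with ω k1 k2 k3 k4 k5
    have k6 := le_abs_self ((P[g | obs T Y (Set.Iic 0)]) (iter T k ω))
    have k7 := le_abs_self ((P[Λ | obs T Y (Set.Iic 0)]) (iter T k ω))
    have k8 : e k ω ≤ s k (iter T k ω) + 4 * |(P[g | obs T Y (Set.Iic 0)]) (iter T k ω)| := by
      rw [← min_add_add_right]
      refine le_min (max_le ?_ ?_) (max_le ?_ ?_)
      · have := hρ0 k (iter T k ω)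
        positivity
      · rw [abs_le] at k1 k2
        simp only [hρ]
        linarith [k1.1, k1.2, k2.1, k2.2]
      · simp only [hL]; positivity
      · rw [abs_le] at k3 k4
        simp only [hL]
        linarith [k3.1, k3.2, k4.1, k4.2, abs_nonneg ((P[g | obs T Y (Set.Iic 0)]) (iter T k ω))]
    rw [abs_of_nonneg (sub_nonneg.2 (min_le_left _ _))]
    rcases min_cases (e k ω) (s k (iter T k ω)) with h | h
    · rw [h.1, sub_self]; positivity
    · rw [h.1]; linarith

/-- Split the loss difference into two centred terms and the conditional regret. Replacing the
regret by its positive part only lowers the difference, so a one-sided bound on the regret is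
enough. -/
theorem exists_null_minorant (hT : ∀ k : ℤ, MeasurePreserving (iter T k) P P) (hY : Y ≤ mΩ)
    (H : IsAvgMode P T Null) [Nonempty U]
    (hcore : ∀ f, Measurable f → Integrable f P → CenteredAverages Y P T Null f)
    (hℓ : Measurable (Function.uncurry ℓ)) (hΛ : Integrable Λ P)
    (hdom : ∀ u ω, |ℓ u ω| ≤ Λ ω) (hequi : Equimeasurable P ℓ) (hsep : PointwiseSeparable P ℓ)
    {u w : ℕ → Ω → U} (hu : Admissible T Y u) (hw : IsMeanOptimalSelection Y P T ℓ w) :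
    ∃ b : ℕ → Ω → ℝ, Null b ∧
      ∀ N ω, avg b N ω ≤ avgLoss T ℓ u N ω - avgLoss T ℓ w N ω := by
  have hpast : ∀ {v : ℕ → Ω → U}, Admissible T Y v → ∀ k : ℕ, 1 ≤ k →
      Measurable[obs T Y (Set.Iic (k : ℤ))] (v k) := fun hv k hk =>
    (hv k hk).mono (obs_mono T Y Set.Icc_subset_Iic_self) le_rfl
  have h1 := null_loss_sub_condExp hT hY H hcore hℓ hΛ hdom hequi hsep (hpast hu)
  have h2 := null_loss_sub_condExp hT hY H hcore hℓ hΛ hdom hequi hsep (hpast hw.1)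
  have h3 := null_regret hT hY H hℓ hΛ hdom hequi hsep hu hw.1 fun k hk => by
    obtain ⟨g, hg, hle⟩ := hw.2 k hk
    filter_upwards [hle, hg.2.1 _ ⟨u k, hu k hk, rfl⟩] with ω h4 h5
    linarith
  refine ⟨_, H.sub _ _ (H.sub _ _ h1 h2) h3, fun N ω => ?_⟩
  have h4 : avgLoss T ℓ u N ω - avgLoss T ℓ w N ω
      = avg (fun k ω => lossAt T ℓ k (u k) ω - lossAt T ℓ k (w k) ω) N ω := by
    rw [avg_sub]; rfl
  rw [h4]
  refine avg_mono fun k _ => ?_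
  have := le_max_right 0 ((P[lossAt T ℓ k (w k) | obs T Y (Set.Iic (k : ℤ))]) ω
      - (P[lossAt T ℓ k (u k) | obs T Y (Set.Iic (k : ℤ))]) ω)
  linarith

theorem pathwiseOptimal_of_centeredAverages
    (hT : ∀ k : ℤ, MeasurePreserving (iter T k) P P) (hY : Y ≤ mΩ) [Nonempty U]
    (hcore : ∀ f, Measurable f → Integrable f P → CenteredAverages Y P T (AsNull P) f)
    (hℓ : Measurable (Function.uncurry ℓ)) (hΛ : Integrable Λ P)
    (hdom : ∀ u ω, |ℓ u ω| ≤ Λ ω) (hequi : Equimeasurable P ℓ) (hsep : PointwiseSeparable P ℓ)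
    {w : ℕ → Ω → U} (hw : IsMeanOptimalSelection Y P T ℓ w) : PathwiseOptimal Y P T ℓ w := by
  refine ⟨hw.1, fun u hu => ?_⟩
  obtain ⟨b, hb, hle⟩ := exists_null_minorant hT hY (isAvgMode_asNull hT) hcore hℓ hΛ hdom hequi
    hsep hu hw
  filter_upwards [hb] with ω hω
  have h1 : Tendsto (fun N => ((avg b N ω : ℝ) : EReal)) atTop (𝓝 ((0 : ℝ) : EReal)) :=
    (continuous_coe_real_ereal.tendsto 0).comp hω
  rw [EReal.coe_zero] at h1
  rw [← h1.liminf_eq]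
  exact liminf_le_liminf (Eventually.of_forall fun N => EReal.coe_le_coe_iff.2 (hle N ω))

theorem weaklyPathwiseOptimal_of_centeredAverages
    (hT : ∀ k : ℤ, MeasurePreserving (iter T k) P P) (hY : Y ≤ mΩ) [Nonempty U]
    (hcore : ∀ f, Measurable f → Integrable f P → CenteredAverages Y P T (MeasNull P) f)
    (hℓ : Measurable (Function.uncurry ℓ)) (hΛ : Integrable Λ P)
    (hdom : ∀ u ω, |ℓ u ω| ≤ Λ ω) (hequi : Equimeasurable P ℓ) (hsep : PointwiseSeparable P ℓ)
    {w : ℕ → Ω → U} (hw : IsMeanOptimalSelection Y P T ℓ w) :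
    WeaklyPathwiseOptimal Y P T ℓ w := by
  refine ⟨hw.1, fun u hu ε hε => ?_⟩
  obtain ⟨b, hb, hle⟩ := exists_null_minorant hT hY (isAvgMode_measNull hT) hcore hℓ hΛ hdom hequi
    hsep hu hw
  have h1 : Tendsto (fun N => 1 - P {ω | ε ≤ |avg b N ω|}) atTop (𝓝 (1 - 0)) :=
    ENNReal.Tendsto.sub tendsto_const_nhds (hb ε hε) (Or.inl ENNReal.one_ne_top)
  rw [tsub_zero] at h1
  refine tendsto_of_tendsto_of_tendsto_of_le_of_le h1 tendsto_const_nhds (fun N => ?_)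
    fun N => prob_le_one
  rw [tsub_le_iff_right, ← measure_univ (μ := P)]
  refine (measure_mono ?_).trans (measure_union_le _ _)
  intro ω _
  by_contra hc
  simp only [Set.mem_union, Set.mem_ofPred_eq, not_or, not_le] at hc
  have h2 := (abs_lt.1 hc.2).1
  linarith [hle N ω, hc.1]

end Reduction

/-! ### Equality of σ-fields modulo null sets and reverse martingales -/

/-- An almost sure limit of functions measurable with respect to decreasing σ-fields is, up to a
null set, measurable with respect to their intersection. -/
lemma aestronglyMeasurable_iInf_of_tendsto {mΩ : MeasurableSpace Ω} {P : Measure Ω}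
    {R : ℕ → MeasurableSpace Ω} (hR : Antitone R) {F : ℕ → Ω → ℝ}
    (hF : ∀ n, AEStronglyMeasurable[R n] (F n) P) {f : Ω → ℝ}
    (hlim : ∀ᵐ ω ∂P, Tendsto (fun n => F n ω) atTop (𝓝 (f ω))) :
    AEStronglyMeasurable[⨅ n, R n] f P := by
  choose G hG hFG using hF
  -- An upper limit ignores the first `r` terms, hence is measurable for every `R r`; in the
  -- extended reals it is defined everywhere.
  set L : Ω → EReal := fun ω => limsup (fun n => ((G n ω : ℝ) : EReal)) atTop with hL
  have hLm : ∀ r, Measurable[R r] L := fun r => by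
    have h1 : L = fun ω => limsup (fun n => ((G (n + r) ω : ℝ) : EReal)) atTop := by
      funext ω
      exact (limsup_nat_add (fun n => ((G n ω : ℝ) : EReal)) r).symm
    rw [h1]
    have h2 : ∀ n, Measurable[R r] (fun ω => ((G (n + r) ω : ℝ) : EReal)) := fun n =>
      measurable_coe_real_ereal.comp
        ((hG (n + r)).measurable.mono (hR (Nat.le_add_left r n)) le_rfl)
    exact Measurable.limsup h2
  have hLinf : Measurable[⨅ n, R n] L := by
    intro s hs
    rw [MeasurableSpace.measurableSet_iInf]
    exact fun r => hLm r hs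
  refine ⟨fun ω => (L ω).toReal, (measurable_ereal_toReal.comp hLinf).stronglyMeasurable, ?_⟩
  filter_upwards [hlim, ae_all_iff.2 hFG] with ω h1 h2
  simp only [h2] at h1
  have h3 : Tendsto (fun n => ((G n ω : ℝ) : EReal)) atTop (𝓝 ((f ω : ℝ) : EReal)) :=
    (continuous_coe_real_ereal.tendsto _).comp h1
  rw [hL]
  simp only [h3.limsup_eq, EReal.toReal_coe]

lemma simpleFunc_eq_sum_indicator [MeasurableSpace Ω] (g : SimpleFunc Ω ℝ) :
    (g : Ω → ℝ) = ∑ y ∈ g.range, (g ⁻¹' {y}).indicator fun _ => y := by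
  funext ω
  rw [Finset.sum_apply, Finset.sum_eq_single_of_mem (g ω) (SimpleFunc.mem_range_self g ω)]
  · exact (Set.indicator_of_mem (s := g ⁻¹' {g ω}) rfl _).symm
  · intro y _ hy
    exact Set.indicator_of_notMem (s := g ⁻¹' {y}) (fun h => hy (show g ω = y from h).symm) _

lemma aestronglyMeasurable_of_forall_set {m₁ m₂ mΩ : MeasurableSpace Ω} {P : Measure Ω}
    (h : ∀ s, MeasurableSet[m₁] s → ∃ t, MeasurableSet[m₂] t ∧ s =ᵐ[P] t) {f : Ω → ℝ}
    (hf : StronglyMeasurable[m₁] f) : AEStronglyMeasurable[m₂] f P := by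
  have hind : ∀ s, MeasurableSet[m₁] s → ∀ c : ℝ,
      AEStronglyMeasurable[m₂] (s.indicator fun _ => c) P := by
    intro s hs c
    obtain ⟨t, ht, hst⟩ := h s hs
    exact ⟨t.indicator fun _ => c, (@stronglyMeasurable_const _ _ m₂ _ c).indicator ht,
      indicator_ae_eq_of_ae_eq_set hst⟩
  have hsimple : ∀ g : @SimpleFunc Ω m₁ ℝ, AEStronglyMeasurable[m₂] g P := by
    intro g
    rw [@simpleFunc_eq_sum_indicator Ω m₁ g]
    exact Finset.sum_induction _ (fun q => AEStronglyMeasurable[m₂] q P) (fun _ _ hp hq => hp.add hq)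
      ⟨0, @stronglyMeasurable_zero _ _ m₂ _ _, EventuallyEq.rfl⟩
      fun y _ => hind _ (@SimpleFunc.measurableSet_fiber Ω ℝ m₁ g y) y
  have := aestronglyMeasurable_iInf_of_tendsto (R := fun _ => m₂) antitone_const
    (fun n => hsimple (hf.approx n)) (Eventually.of_forall fun ω => hf.tendsto_approx ω)
  rwa [iInf_const] at this

/-- One half of `EqMod` gives measurability up to null sets, the other the integral identity on sets
of `m₂`. -/
lemma condExp_eq_of_eqMod {m₁ m₂ mΩ : MeasurableSpace Ω} {P : Measure Ω} [IsProbabilityMeasure P]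
    (h₁ : m₁ ≤ mΩ) (h₂ : m₂ ≤ mΩ) (h : EqMod P m₁ m₂) {f : Ω → ℝ} (hf : Integrable f P) :
    P[f | m₁] =ᵐ[P] P[f | m₂] := by
  refine ae_eq_condExp_of_forall_setIntegral_eq h₂ hf
    (fun s _ _ => integrable_condExp.integrableOn) (fun t ht _ => ?_)
    (aestronglyMeasurable_of_forall_set h.1 stronglyMeasurable_condExp)
  obtain ⟨s, hs, hst⟩ := h.2 t ht
  rw [← setIntegral_congr_set hst, ← setIntegral_congr_set hst, setIntegral_condExp h₁ hf hs]

/-- The conditional expectations are orthogonal projections onto a decreasing sequence of closed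
subspaces. Projections onto the increasing orthogonal complements converge; subtract from `x`. By
closedness the limit lies in every subspace. -/
lemma exists_limit_condExpL2 {mΩ : MeasurableSpace Ω} {P : Measure Ω}
    {R : ℕ → MeasurableSpace Ω} (hR : Antitone R) (hle : ∀ n, R n ≤ mΩ) (x : Lp ℝ 2 P) :
    ∃ y : Lp ℝ 2 P, (∀ n, AEStronglyMeasurable[R n] y P) ∧
      Tendsto (fun n => ((condExpL2 ℝ ℝ (hle n) x : lpMeas ℝ ℝ (R n) 2 P) : Lp ℝ 2 P)) atTop
        (𝓝 y) := by
  have : ∀ n, Fact (R n ≤ mΩ) := fun n => ⟨hle n⟩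
  set K : ℕ → Submodule ℝ (Lp ℝ 2 P) := fun n => lpMeas ℝ ℝ (R n) 2 P with hK
  have : ∀ n, (K n).HasOrthogonalProjection := fun n => inferInstanceAs
    (lpMeas ℝ ℝ (R n) 2 P).HasOrthogonalProjection
  have hKanti : Antitone K := fun i j hij g hg => by
    have hg' : AEStronglyMeasurable[R j] g P := mem_lpMeas_iff_aestronglyMeasurable.1 hg
    exact mem_lpMeas_iff_aestronglyMeasurable.2 (hg'.mono (hR hij))
  have hmono : Monotone fun n => (K n)ᗮ := fun i j hij =>
    Submodule.orthogonal_le (hKanti hij)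
  have h1 := Submodule.starProjection_tendsto_closure_iSup (fun n => (K n)ᗮ) hmono x
  have h2 := h1.const_sub x
  have h3 : ∀ n, x - (K n)ᗮ.starProjection x
      = ((condExpL2 ℝ ℝ (hle n) x : lpMeas ℝ ℝ (R n) 2 P) : Lp ℝ 2 P) := fun n => by
    rw [Submodule.starProjection_orthogonal']
    simp only [sub_apply, one_apply_eq_self, sub_sub_cancel]
    rfl
  simp only [h3] at h2
  refine ⟨_, fun n => ?_, h2⟩
  refine (mem_lpMeas_iff_aestronglyMeasurable (𝕜 := ℝ)).1 ?_
  have hclosed : IsClosed (K n : Set (Lp ℝ 2 P)) := by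
    have := Submodule.isClosed_orthogonal (K n)ᗮ
    rwa [Submodule.orthogonal_orthogonal] at this
  refine hclosed.mem_of_tendsto h2 ?_
  filter_upwards [eventually_ge_atTop n] with k hk
  exact hKanti hk (SetLike.coe_mem _)

/-- Reverse martingale convergence in `L¹` for square integrable functions. -/
theorem tendsto_eLpNorm_condExp_iInf {mΩ : MeasurableSpace Ω} {P : Measure Ω}
    [IsProbabilityMeasure P] {R : ℕ → MeasurableSpace Ω} (hR : Antitone R) (hle : ∀ n, R n ≤ mΩ)
    {f : Ω → ℝ} (hf : MemLp f 2 P) :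
    Tendsto (fun n => eLpNorm (P[f | R n] - P[f | ⨅ n, R n]) 1 P) atTop (𝓝 0) := by
  obtain ⟨y, hy, hlim⟩ := exists_limit_condExpL2 hR hle hf.toLp
  have hfi : Integrable f P := hf.integrable one_le_two
  have hyi : Integrable y P := (Lp.memLp y).integrable one_le_two
  have h2 : Tendsto (fun n => eLpNorm (P[f | R n] - ⇑y) 1 P) atTop (𝓝 0) := by
    rw [Lp.tendsto_Lp_iff_tendsto_eLpNorm'] at hlim
    refine tendsto_of_tendsto_of_tendsto_of_le_of_le tendsto_const_nhds hlim (fun _ => zero_le)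
      fun n => ?_
    refine le_trans (eLpNorm_le_eLpNorm_of_exponent_le one_le_two
      (integrable_condExp.sub hyi).1) (le_of_eq ?_)
    exact eLpNorm_congr_ae ((hf.condExpL2_ae_eq_condExp (𝕜 := ℝ) (hle n)).symm.sub
      EventuallyEq.rfl)
  have hinf : ⨅ n, R n ≤ mΩ := (iInf_le R 0).trans (hle 0)
  -- The integrals of `P[f | R n]` over a set of the intersection all equal that of `f`, and they
  -- converge to the integral of `y`.
  have h3 : (y : Ω → ℝ) =ᵐ[P] P[f | ⨅ n, R n] := by
    refine ae_eq_condExp_of_forall_setIntegral_eq hinf hfi (fun s _ _ => hyi.integrableOn)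
      (fun s hs _ => ?_) (aestronglyMeasurable_iInf_of_tendsto hR (F := fun _ => ⇑y) hy
        (Eventually.of_forall fun ω => tendsto_const_nhds))
    have h4 := tendsto_setIntegral_of_L1' (μ := P) (⇑y) hyi.1
      (Eventually.of_forall fun n => integrable_condExp (f := f) (m := R n)) h2 s
    have h5 : ∀ n, ∫ ω in s, (P[f | R n]) ω ∂P = ∫ ω in s, f ω ∂P := fun n =>
      setIntegral_condExp (hle n) hfi ((iInf_le R n) s hs)
    simp only [h5] at h4
    exact tendsto_nhds_unique h4 tendsto_const_nhds
  refine h2.congr fun n => eLpNorm_congr_ae (EventuallyEq.rfl.sub h3)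

/-! ### Second moments and a strong law for bounded orthogonal sequences -/

lemma integral_avg_sq_eq [MeasurableSpace Ω] {P : Measure Ω} (a : ℕ → Ω → ℝ) (N : ℕ)
    (hi : ∀ k l, 1 ≤ k → 1 ≤ l → Integrable (fun ω => a k ω * a l ω) P) :
    ∫ ω, avg a N ω ^ 2 ∂P
      = (1 / (N : ℝ)) ^ 2 * ∑ k ∈ Finset.Icc 1 N, ∑ l ∈ Finset.Icc 1 N, ∫ ω, a k ω * a l ω ∂P := by
  have h1 : ∀ ω, avg a N ω ^ 2 = (1 / (N : ℝ)) ^ 2 *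
      ∑ k ∈ Finset.Icc 1 N, ∑ l ∈ Finset.Icc 1 N, a k ω * a l ω := fun ω => by
    rw [avg, mul_pow, sq (∑ k ∈ Finset.Icc 1 N, a k ω), Finset.sum_mul_sum]
  simp only [h1]
  rw [integral_const_mul, integral_finsetSum]
  · congr 1
    refine Finset.sum_congr rfl fun k hk => ?_
    rw [integral_finsetSum]
    exact fun l hl => hi k l (Finset.mem_Icc.1 hk).1 (Finset.mem_Icc.1 hl).1
  · exact fun k hk => integrable_finsetSum _ fun l hl =>
      hi k l (Finset.mem_Icc.1 hk).1 (Finset.mem_Icc.1 hl).1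

lemma integrable_mul_of_bounded [MeasurableSpace Ω] {P : Measure Ω} [IsProbabilityMeasure P]
    {f g : Ω → ℝ} (hf : AEStronglyMeasurable f P) (hg : AEStronglyMeasurable g P) {C D : ℝ}
    (hfC : ∀ᵐ ω ∂P, |f ω| ≤ C) (hgD : ∀ᵐ ω ∂P, |g ω| ≤ D) :
    Integrable (fun ω => f ω * g ω) P := by
  refine (integrable_const (C * D)).mono' (hf.mul hg) ?_
  filter_upwards [hfC, hgD] with ω h1 h2
  rw [Real.norm_eq_abs, abs_mul]
  exact mul_le_mul h1 h2 (abs_nonneg _) ((abs_nonneg _).trans h1)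

lemma integral_avg_sq_le_of_orthogonal [MeasurableSpace Ω] {P : Measure Ω}
    [IsProbabilityMeasure P] {a : ℕ → Ω → ℝ} {C : ℝ}
    (ha : ∀ k, 1 ≤ k → AEStronglyMeasurable (a k) P) (hC : ∀ k, 1 ≤ k → ∀ᵐ ω ∂P, |a k ω| ≤ C)
    (horth : ∀ k l, 1 ≤ k → k < l → ∫ ω, a k ω * a l ω ∂P = 0) (N : ℕ) :
    ∫ ω, avg a N ω ^ 2 ∂P ≤ C ^ 2 / N := by
  have hi : ∀ k l, 1 ≤ k → 1 ≤ l → Integrable (fun ω => a k ω * a l ω) P := fun k l hk hl =>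
    integrable_mul_of_bounded (ha k hk) (ha l hl) (hC k hk) (hC l hl)
  rw [integral_avg_sq_eq a N hi]
  have h1 : ∀ k ∈ Finset.Icc 1 N, ∑ l ∈ Finset.Icc 1 N, ∫ ω, a k ω * a l ω ∂P ≤ C ^ 2 := by
    intro k hk
    have hk1 := (Finset.mem_Icc.1 hk).1
    rw [Finset.sum_eq_single_of_mem k hk]
    · have h2 : ∫ ω, a k ω * a k ω ∂P ≤ ∫ _, C ^ 2 ∂P := by
        refine integral_mono_ae (hi k k hk1 hk1) (integrable_const _) ?_
        filter_upwards [hC k hk1] with ω hω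
        rw [← sq, ← sq_abs]
        exact pow_le_pow_left₀ (abs_nonneg _) hω 2
      simpa using h2
    · intro l hl hne
      rcases lt_or_gt_of_ne hne with h | h
      · simp only [mul_comm (a k _)]
        exact horth l k (Finset.mem_Icc.1 hl).1 h
      · exact horth k l hk1 h
  refine (mul_le_mul_of_nonneg_left (Finset.sum_le_sum h1) (by positivity)).trans (le_of_eq ?_)
  rw [Finset.sum_const, Nat.card_Icc, nsmul_eq_mul]
  rcases Nat.eq_zero_or_pos N with rfl | hN
  · simp
  · have : (N : ℝ) ≠ 0 := by positivity
    simp only [Nat.add_sub_cancel]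
    field_simp

/-- With `n = √N` rounded down, at most `2n` terms follow the `n²`-th, and division by `N ≥ n²`
makes their contribution at most `2C/n`. -/
lemma abs_avg_le_of_sqrt {a : ℕ → Ω → ℝ} {C : ℝ} {ω : Ω} (hC : ∀ k, 1 ≤ k → |a k ω| ≤ C) (N : ℕ)
    (hN : 1 ≤ N) :
    |avg a N ω| ≤ |avg a (N.sqrt * N.sqrt) ω| + 2 * C / (N.sqrt : ℝ) := by
  set n := N.sqrt with hn
  have hn1 : 1 ≤ n := Nat.le_sqrt.2 (by simpa using hN)
  have hnN : n * n ≤ N := Nat.sqrt_le N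
  have hNn : N ≤ n * n + n + n := Nat.sqrt_le_add N
  have hC0 : 0 ≤ C := (abs_nonneg _).trans (hC 1 le_rfl)
  have hn0 : (0 : ℝ) < n := by exact_mod_cast hn1
  have hN0 : (0 : ℝ) < N := by exact_mod_cast hN
  have hnN' : (n : ℝ) * n ≤ N := by exact_mod_cast hnN
  have h1 : ∑ k ∈ Finset.Icc 1 N, a k ω
      = ∑ k ∈ Finset.Icc 1 (n * n), a k ω + ∑ k ∈ Finset.Ioc (n * n) N, a k ω := by
    have := Finset.sum_Ioc_consecutive (fun k => a k ω) (Nat.zero_le (n * n)) hnN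
    exact this.symm
  have h2 : |∑ k ∈ Finset.Ioc (n * n) N, a k ω| ≤ 2 * n * C := by
    refine (Finset.abs_sum_le_sum_abs _ _).trans ?_
    refine (Finset.sum_le_card_nsmul _ _ C fun k hk =>
      hC k (by have := (Finset.mem_Ioc.1 hk).1; omega)).trans ?_
    rw [Nat.card_Ioc, nsmul_eq_mul]
    refine mul_le_mul_of_nonneg_right ?_ hC0
    have : N - n * n ≤ 2 * n := by omega
    exact_mod_cast this
  have h3 : |avg a (n * n) ω| = |∑ k ∈ Finset.Icc 1 (n * n), a k ω| / ((n : ℝ) * n) := by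
    rw [avg, abs_mul, abs_of_nonneg (by positivity)]
    push_cast
    rw [one_div, inv_mul_eq_div]
  have h4 : |avg a N ω| = |∑ k ∈ Finset.Icc 1 N, a k ω| / N := by
    rw [avg, abs_mul, abs_of_nonneg (by positivity), one_div, inv_mul_eq_div]
  rw [h3, h4, h1]
  calc |∑ k ∈ Finset.Icc 1 (n * n), a k ω + ∑ k ∈ Finset.Ioc (n * n) N, a k ω| / N
      ≤ (|∑ k ∈ Finset.Icc 1 (n * n), a k ω| + 2 * n * C) / N :=
        div_le_div_of_nonneg_right ((abs_add_le _ _).trans (by linarith)) hN0.le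
    _ ≤ (|∑ k ∈ Finset.Icc 1 (n * n), a k ω| + 2 * n * C) / ((n : ℝ) * n) :=
        div_le_div_of_nonneg_left (by positivity) (by positivity) hnN'
    _ = _ := by rw [add_div]; congr 1; field_simp

/-- Strong law of large numbers for bounded orthogonal sequences. -/
theorem asNull_of_orthogonal [MeasurableSpace Ω] {P : Measure Ω}
    [IsProbabilityMeasure P] {a : ℕ → Ω → ℝ} {C : ℝ}
    (ha : ∀ k, 1 ≤ k → AEStronglyMeasurable (a k) P) (hC : ∀ k, 1 ≤ k → ∀ᵐ ω ∂P, |a k ω| ≤ C)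
    (horth : ∀ k l, 1 ≤ k → k < l → ∫ ω, a k ω * a l ω ∂P = 0) : AsNull P a := by
  have hall : ∀ᵐ ω ∂P, ∀ k, 1 ≤ k → |a k ω| ≤ C := ae_all_iff.2 fun k => by
    by_cases hk : 1 ≤ k
    · filter_upwards [hC k hk] with ω hω _ using hω
    · exact Eventually.of_forall fun ω h => absurd h hk
  have havg : ∀ N, AEStronglyMeasurable (avg a N) P := fun N => by
    have h1 : AEMeasurable (fun ω => ∑ k ∈ Finset.Icc 1 N, a k ω) P :=
      Finset.aemeasurable_fun_sum _ fun k hk => (ha k (Finset.mem_Icc.1 hk).1).aemeasurable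
    exact (h1.const_mul _).aestronglyMeasurable
  have hsq : ∀ N, Integrable (fun ω => avg a N ω ^ 2) P := fun N => by
    have hb : ∀ᵐ ω ∂P, |avg a N ω| ≤ avg (fun _ _ => C) N ω := by
      filter_upwards [hall] with ω hω
      exact (abs_avg_le _ _ _).trans (avg_mono hω)
    simp only [sq]
    exact integrable_mul_of_bounded (D := 1 / (N : ℝ) * ∑ k ∈ Finset.Icc 1 N, C) (havg N) (havg N) hb hb
  -- Along the squares the second moments are at most `C²/n²`, which is summable; so these averages
  -- tend to zero almost surely, and boundedness fills the gaps.
  have hsum : ∫⁻ ω, ∑' n : ℕ, ENNReal.ofReal (avg a (n * n) ω ^ 2) ∂P ≠ ∞ := by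
    rw [lintegral_tsum fun n => ((havg (n * n)).aemeasurable.pow_const 2).ennreal_ofReal]
    have hle : ∀ n : ℕ, ∫⁻ ω, ENNReal.ofReal (avg a (n * n) ω ^ 2) ∂P
        ≤ ENNReal.ofReal (C ^ 2 * (1 / (n : ℝ) ^ 2)) := fun n => by
      rw [← ofReal_integral_eq_lintegral_ofReal (hsq (n * n))
        (Eventually.of_forall fun ω => sq_nonneg _)]
      refine ENNReal.ofReal_le_ofReal
        ((integral_avg_sq_le_of_orthogonal ha hC horth (n * n)).trans (le_of_eq ?_))
      push_cast
      rw [sq (n : ℝ), mul_one_div]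
    have hs : Summable fun n : ℕ => C ^ 2 * (1 / (n : ℝ) ^ 2) :=
      (Real.summable_one_div_nat_pow.2 one_lt_two).mul_left _
    exact ((ENNReal.tsum_le_tsum hle).trans_lt
      (lt_top_iff_ne_top.2 hs.tsum_ofReal_ne_top)).ne
  have hfin : ∀ᵐ ω ∂P, ∑' n : ℕ, ENNReal.ofReal (avg a (n * n) ω ^ 2) < ∞ :=
    ae_lt_top' (AEMeasurable.tsum fun n =>
      ((havg (n * n)).aemeasurable.pow_const 2).ennreal_ofReal) hsum
  filter_upwards [hfin, hall] with ω h1 h2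
  have h3 : Tendsto (fun n : ℕ => avg a (n * n) ω ^ 2) atTop (𝓝 0) := by
    have := (ENNReal.tendsto_toReal ENNReal.zero_ne_top).comp
      (ENNReal.tendsto_atTop_zero_of_tsum_ne_top h1.ne)
    simpa [Function.comp_def, ENNReal.toReal_ofReal (sq_nonneg _)] using this
  have h4 : Tendsto (fun n : ℕ => |avg a (n * n) ω|) atTop (𝓝 0) := by
    have := (Real.continuous_sqrt.tendsto 0).comp h3
    simpa [Function.comp_def, Real.sqrt_sq_eq_abs] using this
  have h5 : Tendsto (fun n : ℕ => |avg a (n * n) ω| + 2 * C / (n : ℝ)) atTop (𝓝 0) := by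
    simpa using h4.add (tendsto_const_div_atTop_nhds_zero_nat (2 * C))
  have hsqrt : Tendsto Nat.sqrt atTop atTop :=
    tendsto_atTop_atTop.2 fun b => ⟨b * b, fun N hN => Nat.le_sqrt.2 hN⟩
  rw [tendsto_zero_iff_abs_tendsto_zero]
  refine tendsto_of_tendsto_of_tendsto_of_le_of_le' tendsto_const_nhds (h5.comp hsqrt)
    (Eventually.of_forall fun N => abs_nonneg _) ?_
  filter_upwards [eventually_ge_atTop 1] with N hN
  exact abs_avg_le_of_sqrt h2 N hN

lemma integral_abs_le_of_eLpNorm_le [MeasurableSpace Ω] {P : Measure Ω} {f : Ω → ℝ}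
    (hf : Integrable f P) {ε : ℝ} (hε : 0 ≤ ε) (h : eLpNorm f 1 P ≤ ENNReal.ofReal ε) :
    ∫ ω, |f ω| ∂P ≤ ε := by
  rw [eLpNorm_one_eq_lintegral_enorm] at h
  have := integral_norm_eq_lintegral_enorm hf.1
  simp only [Real.norm_eq_abs] at this
  rw [this]
  exact ENNReal.toReal_le_of_le_ofReal hε h

/-- Replacing `f` by `f'` changes each term by at most `|f - f'| + |E[f - f' | Z]|` at `T^k ω`, of
integral at most `2 ∫ |f - f'|`. The property is thus closed in `L¹`, and dense classes of `f`
suffice. -/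
lemma CenteredAverages.of_approx {Y : MeasurableSpace Ω} [mΩ : MeasurableSpace Ω] {P : Measure Ω}
    [IsProbabilityMeasure P] {T : Equiv.Perm Ω} {Null : (ℕ → Ω → ℝ) → Prop}
    (hT : ∀ k : ℤ, MeasurePreserving (iter T k) P P) (hY : Y ≤ mΩ) (H : IsAvgMode P T Null)
    {f : Ω → ℝ} (hfm : Measurable f) (hf : Integrable f P)
    (h : ∀ ε : ℝ, 0 < ε → ∃ f' : Ω → ℝ, Measurable f' ∧ Integrable f' P ∧
      ∫ ω, |f ω - f' ω| ∂P ≤ ε ∧ CenteredAverages Y P T Null f') :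
    CenteredAverages Y P T Null f := by
  intro B hB
  refine H.approx _ fun ε hε => ?_
  obtain ⟨f', hfm', hf', hε', hc⟩ := h (ε / 2) (half_pos hε)
  have hZ : obs T Y (Set.Iic 0) ≤ mΩ := obs_le hT hY _
  set E := P[f - f' | obs T Y (Set.Iic 0)] with hE
  have hEm : Measurable E := (stronglyMeasurable_condExp.mono hZ).measurable
  refine ⟨_, fun ω => |f ω - f' ω| + |E ω|, hc B hB,
    (_root_.measurable_abs.comp (hfm.sub hfm')).add (_root_.measurable_abs.comp hEm),
    (hf.sub hf').abs.add integrable_condExp.abs, fun ω => by positivity, ?_, fun k _ => ?_⟩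
  · have hi1 : Integrable (fun ω => |f ω - f' ω|) P := (hf.sub hf').abs
    have hi2 : Integrable (fun ω => |E ω|) P := integrable_condExp.abs
    rw [integral_add hi1 hi2]
    have h1 := integral_abs_condExp_le (μ := P) (m := obs T Y (Set.Iic 0)) (f - f')
    simp only [Pi.sub_apply] at h1
    linarith
  · have h1 := (hT k).quasiMeasurePreserving.ae (condExp_sub hf hf' (obs T Y (Set.Iic 0)))
    filter_upwards [h1] with ω hω
    rw [Pi.sub_apply] at hω
    by_cases hmem : ω ∈ B k
    · rw [Set.indicator_of_mem hmem, Set.indicator_of_mem hmem, hE, hω]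
      refine le_trans (le_of_eq ?_) (abs_sub _ _)
      congr 1
      ring
    · rw [Set.indicator_of_notMem hmem, Set.indicator_of_notMem hmem, sub_self, abs_zero]
      positivity

lemma exists_truncation [MeasurableSpace Ω] {P : Measure Ω} {f : Ω → ℝ} (hfm : Measurable f)
    (hf : Integrable f P) {ε : ℝ} (hε : 0 < ε) :
    ∃ C : ℝ, 0 ≤ C ∧ ∫ ω, |f ω - max (-C) (min C (f ω))| ∂P ≤ ε := by
  have hlim : Tendsto (fun n : ℕ => ∫ ω, |f ω - max (-(n : ℝ)) (min n (f ω))| ∂P) atTop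
      (𝓝 (∫ _, 0 ∂P)) := by
    refine tendsto_integral_of_dominated_convergence (fun ω => |f ω|) (fun n => ?_) hf.abs
      (fun n => Eventually.of_forall fun ω => ?_) (Eventually.of_forall fun ω => ?_)
    · exact (_root_.measurable_abs.comp (hfm.sub (measurable_const.max
        (measurable_const.min hfm)))).aestronglyMeasurable
    · rw [Real.norm_eq_abs, abs_abs]
      have hn : (0 : ℝ) ≤ n := n.cast_nonneg
      rcases le_total (f ω) n with h | h
      · rw [min_eq_right h]
        rcases le_total (-(n : ℝ)) (f ω) with h' | h'
        · rw [max_eq_right h', sub_self, abs_zero]; positivity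
        · rw [max_eq_left h', abs_of_nonpos (by linarith), abs_of_nonpos (by linarith)]
          linarith
      · rw [min_eq_left h, max_eq_right (by linarith), abs_of_nonneg (by linarith),
          abs_of_nonneg (by linarith)]
        linarith
    · obtain ⟨n, hn⟩ := exists_nat_ge |f ω|
      refine tendsto_const_nhds.congr' ?_
      filter_upwards [eventually_ge_atTop n] with k hk
      have hk' : |f ω| ≤ k := hn.trans (by exact_mod_cast hk)
      rw [abs_le] at hk'
      rw [min_eq_right hk'.2, max_eq_right hk'.1, sub_self, abs_zero]
  rw [integral_zero] at hlim
  obtain ⟨n, hn⟩ := ((tendsto_order.1 hlim).2 ε hε).exists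
  exact ⟨n, n.cast_nonneg, hn.le⟩

lemma pull_mono_of_le_pull_one {X : MeasurableSpace Ω} {T : Equiv.Perm Ω} (hX : X ≤ pull T 1 X)
    {i j : ℤ} (hij : i ≤ j) :
    pull T i X ≤ pull T j X := by
  obtain ⟨n, rfl⟩ := Int.le.dest hij
  clear hij
  induction n with
  | zero => simp
  | succ n ih =>
    refine ih.trans ?_
    have := pull_mono T (i + n) hX
    rw [pull_pull] at this
    have h : (1 : ℤ) + (i + n) = i + (n + 1 : ℕ) := by push_cast; ring
    rwa [h] at this

/-! ### Conditional K-automorphisms: almost sure convergence -/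

section KAutomorphism

variable {Y X W V : MeasurableSpace Ω} [mΩ : MeasurableSpace Ω] {P : Measure Ω}
  [IsProbabilityMeasure P] {T : Equiv.Perm Ω}

/-- For `k < l` the term at time `k` is measurable for `T^{-k} W ⊆ T^{-l} V`, and so is `1_{B_l}`
because `Z ⊆ V`. The increment at time `l` has zero conditional expectation given `T^{-l} V`; hence
the terms are orthogonal and the strong law applies. -/
lemma asNull_increment (hT : ∀ k : ℤ, MeasurePreserving (iter T k) P P) (hVW : V ≤ W)
    (hW : W ≤ mΩ) (hZV : obs T Y (Set.Iic 0) ≤ V)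
    (hpull : ∀ k l : ℕ, k < l → pull T k W ≤ pull T l V) {f : Ω → ℝ} {C : ℝ}
    (hC : ∀ᵐ ω ∂P, |f ω| ≤ C) {B : ℕ → Set Ω}
    (hB : ∀ k : ℕ, 1 ≤ k → MeasurableSet[obs T Y (Set.Iic (k : ℤ))] (B k)) :
    AsNull P fun k => (B k).indicator
      fun ω => (P[f | W]) (iter T k ω) - (P[f | V]) (iter T k ω) := by
  set d : Ω → ℝ := fun ω => (P[f | W]) ω - (P[f | V]) ω with hd
  have hVm : V ≤ mΩ := hVW.trans hW
  have hdW : StronglyMeasurable[W] d :=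
    stronglyMeasurable_condExp.sub (stronglyMeasurable_condExp.mono hVW)
  have hdi : Integrable d P := integrable_condExp.sub integrable_condExp
  have hdC : ∀ᵐ ω ∂P, |d ω| ≤ C + C := by
    filter_upwards [ae_bdd_abs_condExp_of_ae_bdd_abs (m := W) hC,
      ae_bdd_abs_condExp_of_ae_bdd_abs (m := V) hC] with ω h1 h2
    exact (abs_sub _ _).trans (add_le_add h1 h2)
  have hC0 : 0 ≤ C + C := by
    obtain ⟨ω, hω⟩ := hdC.exists
    exact (abs_nonneg _).trans hω
  have hBW : ∀ k : ℕ, 1 ≤ k → MeasurableSet[pull T k W] (B k) := fun k hk => by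
    have h1 := hB k hk
    rw [obs_Iic_eq_pull] at h1
    exact pull_mono T k (hZV.trans hVW) _ h1
  have hdk : ∀ k : ℕ, StronglyMeasurable[pull T k W] fun ω => d (iter T k ω) := fun k =>
    hdW.comp_measurable (measurable_iter_pull T k W)
  have hak : ∀ k : ℕ, 1 ≤ k →
      StronglyMeasurable[pull T k W] ((B k).indicator fun ω => d (iter T k ω)) := fun k hk =>
    (hdk k).indicator (hBW k hk)
  have hWle : ∀ k : ℕ, pull T k W ≤ mΩ := fun k => pull_le hT k hW
  have haC : ∀ k : ℕ, ∀ᵐ ω ∂P, |(B k).indicator (fun ω => d (iter T k ω)) ω| ≤ C + C := fun k => by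
    filter_upwards [(hT k).quasiMeasurePreserving.ae hdC] with ω hω
    by_cases h : ω ∈ B k
    · rwa [Set.indicator_of_mem h]
    · rwa [Set.indicator_of_notMem h, abs_zero]
  refine asNull_of_orthogonal (a := fun k => (B k).indicator fun ω => d (iter T k ω))
    (fun k hk => ((hak k hk).mono (hWle k)).aestronglyMeasurable) (fun k _ => haC k)
    fun k l hk hkl => ?_
  have hl : 1 ≤ l := hk.trans hkl.le
  have hVl : pull T l V ≤ mΩ := pull_le hT l hVm
  have hBl : MeasurableSet[pull T l V] (B l) := by
    have h1 := hB l hl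
    rw [obs_Iic_eq_pull] at h1
    exact pull_mono T l hZV _ h1
  set q : Ω → ℝ := (B l).indicator ((B k).indicator fun ω => d (iter T k ω)) with hq
  have hqm : StronglyMeasurable[pull T l V] q := ((hak k hk).mono (hpull k l hkl)).indicator hBl
  have hqC : ∀ᵐ ω ∂P, |q ω| ≤ C + C := by
    filter_upwards [haC k] with ω hω
    by_cases h : ω ∈ B l
    · rwa [hq, Set.indicator_of_mem h]
    · rwa [hq, Set.indicator_of_notMem h, abs_zero]
  have hdl : Integrable (fun ω => d (iter T l ω)) P := (hT l).integrable_comp_of_integrable hdi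
  have hqd : Integrable (q * fun ω => d (iter T l ω)) P :=
    integrable_mul_of_bounded (hqm.mono hVl).aestronglyMeasurable hdl.1 hqC
      ((hT l).quasiMeasurePreserving.ae hdC)
  have hprod : (fun ω => (B k).indicator (fun ω => d (iter T k ω)) ω
      * (B l).indicator (fun ω => d (iter T l ω)) ω) = q * fun ω => d (iter T l ω) := by
    funext ω
    rw [Pi.mul_apply, hq]
    by_cases h : ω ∈ B l
    · rw [Set.indicator_of_mem h, Set.indicator_of_mem h]
    · rw [Set.indicator_of_notMem h, Set.indicator_of_notMem h, mul_zero, zero_mul]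
  have hd0 : P[d | V] =ᵐ[P] 0 := by
    have h1 := condExp_sub (integrable_condExp (f := f) (m := W) (μ := P))
      (integrable_condExp (f := f) (m := V) (μ := P)) V
    have h2 : P[P[f | V] | V] = P[f | V] :=
      condExp_of_stronglyMeasurable hVm stronglyMeasurable_condExp integrable_condExp
    filter_upwards [h1, condExp_condExp_of_le (f := f) (μ := P) hVW hW] with ω h3 h4
    have h5 : (P[d | V]) ω = (P[P[f | W] | V]) ω - (P[P[f | V] | V]) ω := h3
    rw [h5, h4, h2, sub_self]
    rfl
  have hcond : P[q * fun ω => d (iter T l ω) | pull T l V] =ᵐ[P] 0 := by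
    filter_upwards [condExp_mul_of_stronglyMeasurable_left hqm hqd hdl,
      condExp_pull hT hVm hdi l, (hT l).quasiMeasurePreserving.ae hd0] with ω h1 h2 h3
    rw [h1, Pi.mul_apply, h2, h3]
    simp
  show ∫ ω, (B k).indicator (fun ω => d (iter T k ω)) ω
      * (B l).indicator (fun ω => d (iter T l ω)) ω ∂P = 0
  rw [hprod, ← integral_condExp hVl, integral_congr_ae hcond]
  simp

/-- Telescope along `W_j = Z ∨ T^{-j} 𝒳`: at level `m` the conditional expectation is `f` itself,
and far down it is `L¹`-close to `E[f | Z]` by reverse martingale convergence. Finitely many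
increments remain, each with vanishing averages. -/
lemma centeredAverages_of_stronglyMeasurable_pull
    (hT : ∀ k : ℤ, MeasurePreserving (iter T k) P P) (hY : Y ≤ mΩ) (hXm : X ≤ mΩ)
    (hX : X ≤ pull T 1 X)
    (hinf : EqMod P (⨅ k : ℕ, ⨅ _ : 1 ≤ k, obs T Y (Set.Iic 0) ⊔ pull T (-(k : ℤ)) X)
      (obs T Y (Set.Iic 0)))
    {f : Ω → ℝ} {m : ℕ} (hfm : StronglyMeasurable[pull T m X] f) (hf : Integrable f P) {C : ℝ}
    (hC : ∀ᵐ ω ∂P, |f ω| ≤ C) : CenteredAverages Y P T (AsNull P) f := by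
  intro B hB
  have hZ : obs T Y (Set.Iic 0) ≤ mΩ := obs_le hT hY _
  set W : ℤ → MeasurableSpace Ω := fun j => obs T Y (Set.Iic 0) ⊔ pull T j X with hW
  have hWle : ∀ j, W j ≤ mΩ := fun j => sup_le hZ (pull_le hT j hXm)
  have hWmono : Monotone W := fun i j hij =>
    sup_le_sup le_rfl (pull_mono_of_le_pull_one hX hij)
  -- One step in time makes up for one level of the filtration: `T^{-k} W_{j+1}` is `𝒴_{-∞,k} ∨
  -- T^{-(j+1+k)} 𝒳`, and `j + 1 + k ≤ j + l`.
  have hWpull : ∀ (j : ℤ) (k l : ℕ), k < l → pull T k (W (j + 1)) ≤ pull T l (W j) := by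
    intro j k l hkl
    rw [hW, pull_sup, pull_sup, pull_pull, pull_pull, ← obs_Iic_eq_pull, ← obs_Iic_eq_pull]
    exact sup_le_sup (obs_mono T Y (Set.Iic_subset_Iic.2 (by exact_mod_cast hkl.le)))
      (pull_mono_of_le_pull_one hX (by omega))
  -- The intersection in the hypothesis runs over `k ≥ 1`, hence the shift by one.
  set R : ℕ → MeasurableSpace Ω := fun r => W (-((r : ℤ) + 1)) with hR
  have hRanti : Antitone R := fun i j hij => hWmono (by simp only [neg_le_neg_iff]; omega)
  have hRinf : ⨅ r, R r
      = ⨅ k : ℕ, ⨅ _ : 1 ≤ k, obs T Y (Set.Iic 0) ⊔ pull T (-(k : ℤ)) X := by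
    refine le_antisymm (le_iInf₂ fun k hk => ?_) (le_iInf fun r => ?_)
    · obtain ⟨r, rfl⟩ := Nat.exists_eq_add_of_le' hk
      exact (iInf_le R r).trans (by simp [hR, hW])
    · exact (iInf₂_le (r + 1) (Nat.le_add_left 1 r)).trans (by simp [hR, hW])
  have hlim := tendsto_eLpNorm_condExp_iInf (P := P) hRanti (fun n => hWle _)
    (MemLp.of_bound hf.1 C (by simpa using hC))
  have hinfZ : P[f | ⨅ r, R r] =ᵐ[P] P[f | obs T Y (Set.Iic 0)] := by
    rw [hRinf]
    refine condExp_eq_of_eqMod ?_ hZ hinf hf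
    rw [← hRinf]
    exact (iInf_le R 0).trans (hWle _)
  have hfW : P[f | W m] = f :=
    condExp_of_stronglyMeasurable (hWle m) (hfm.mono le_sup_right) hf
  refine (isAvgMode_asNull hT).approx _ fun ε hε => ?_
  obtain ⟨r, hr⟩ := (ENNReal.tendsto_nhds_zero.1 hlim (ENNReal.ofReal ε)
    (ENNReal.ofReal_pos.2 hε)).exists
  have hr' : ∫ ω, |(P[f | R r]) ω - (P[f | obs T Y (Set.Iic 0)]) ω| ∂P ≤ ε := by
    refine integral_abs_le_of_eLpNorm_le (integrable_condExp.sub integrable_condExp) hε.le ?_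
    refine le_trans (le_of_eq ?_) hr
    exact eLpNorm_congr_ae (EventuallyEq.rfl.sub hinfZ.symm)
  let D : ℕ → ℕ → Ω → ℝ := fun i k ω =>
    (P[f | W ((m : ℤ) - i)]) (iter T k ω) - (P[f | W ((m : ℤ) - (i + 1 : ℕ))]) (iter T k ω)
  -- Level `m` down to level `-(r + 1)` takes `m + r + 1` increments.
  refine ⟨fun k ω => ∑ i ∈ Finset.range (m + r + 1), (B k).indicator (D i k) ω,
    fun ω => |(P[f | R r]) ω - (P[f | obs T Y (Set.Iic 0)]) ω|, ?_,
    _root_.measurable_abs.comp ((stronglyMeasurable_condExp.mono (hWle _)).measurable.sub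
      (stronglyMeasurable_condExp.mono hZ).measurable),
    (integrable_condExp.sub integrable_condExp).abs, fun ω => abs_nonneg _, hr', fun k _ => ?_⟩
  · refine (isAvgMode_asNull hT).sum _ (fun i k => (B k).indicator (D i k)) fun i _ => ?_
    refine asNull_increment hT (hWmono (by push_cast; linarith)) (hWle _) le_sup_left
      (fun k l hkl => ?_) hC hB
    have := hWpull ((m : ℤ) - (i + 1 : ℕ)) k l hkl
    have hidx : ((m : ℤ) - (i + 1 : ℕ)) + 1 = (m : ℤ) - i := by push_cast; ring
    rwa [hidx] at this
  · refine Eventually.of_forall fun ω => ?_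
    by_cases h : ω ∈ B k
    · simp only [Set.indicator_of_mem h, D]
      rw [Finset.sum_range_sub' (fun i : ℕ => (P[f | W ((m : ℤ) - i)]) (iter T k ω))]
      have hidx : (m : ℤ) - (m + r + 1 : ℕ) = -((r : ℤ) + 1) := by push_cast; ring
      rw [hidx, Nat.cast_zero, sub_zero, hfW]
      refine le_of_eq ?_
      simp only [hR]
      congr 1
      ring
    · simp only [Set.indicator_of_notMem h]
      simp

/-- Two `L¹` approximations: truncation gives a bounded function, then conditioning on `T^{-(n+1)}
𝒳` gives one measurable at a finite level. Conditioning preserves the bound. -/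
lemma centeredAverages_of_exhausting
    (hT : ∀ k : ℤ, MeasurePreserving (iter T k) P P) (hY : Y ≤ mΩ) (hXm : X ≤ mΩ)
    (hX : X ≤ pull T 1 X) (hsup : EqMod P (⨆ k : ℕ, ⨆ _ : 1 ≤ k, pull T k X) mΩ)
    (hinf : EqMod P (⨅ k : ℕ, ⨅ _ : 1 ≤ k, obs T Y (Set.Iic 0) ⊔ pull T (-(k : ℤ)) X)
      (obs T Y (Set.Iic 0)))
    {f : Ω → ℝ} (hfm : Measurable f)
    (hf : Integrable f P) : CenteredAverages Y P T (AsNull P) f := by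
  refine CenteredAverages.of_approx hT hY (isAvgMode_asNull hT) hfm hf fun ε hε => ?_
  obtain ⟨C, hC0, hCε⟩ := exists_truncation hfm hf hε
  have hgm : Measurable fun ω => max (-C) (min C (f ω)) :=
    measurable_const.max (measurable_const.min hfm)
  have hgC : ∀ ω, |max (-C) (min C (f ω))| ≤ C := fun ω =>
    abs_le.2 ⟨le_max_left _ _, max_le (by linarith) (min_le_left _ _)⟩
  have hgi : Integrable (fun ω => max (-C) (min C (f ω))) P :=
    (integrable_const C).mono' hgm.aestronglyMeasurable (Eventually.of_forall hgC)
  refine ⟨_, hgm, hgi, hCε, ?_⟩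
  refine CenteredAverages.of_approx hT hY (isAvgMode_asNull hT) hgm hgi fun δ hδ => ?_
  set g : Ω → ℝ := fun ω => max (-C) (min C (f ω))
  let ℱ : Filtration ℕ mΩ :=
    { seq := fun n => pull T ((n + 1 : ℕ) : ℤ) X
      mono' := fun i j hij => pull_mono_of_le_pull_one hX (by exact_mod_cast Nat.succ_le_succ hij)
      le' := fun n => pull_le hT _ hXm }
  have hℱ : ⨆ n, ℱ n = ⨆ k : ℕ, ⨆ _ : 1 ≤ k, pull T k X := by
    refine le_antisymm (iSup_le fun n => ?_) (iSup₂_le fun k hk => ?_)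
    · exact le_iSup₂ (f := fun (k : ℕ) (_ : 1 ≤ k) => pull T k X) (n + 1) (Nat.le_add_left 1 n)
    · obtain ⟨n, rfl⟩ := Nat.exists_eq_add_of_le' hk
      exact le_iSup (fun n => (ℱ n : MeasurableSpace Ω)) n
  have hsupg : P[g | ⨆ n, ℱ n] =ᵐ[P] g := by
    have h1 := condExp_eq_of_eqMod (P := P)
      (iSup₂_le fun (k : ℕ) _ => pull_le hT k hXm) le_rfl hsup hgi
    rw [hℱ]
    refine h1.trans (Eventually.of_forall fun ω => ?_)
    rw [condExp_of_stronglyMeasurable le_rfl hgm.stronglyMeasurable hgi]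
  obtain ⟨n, hn⟩ := (ENNReal.tendsto_nhds_zero.1 (tendsto_eLpNorm_condExp (μ := P) (ℱ := ℱ) g)
    (ENNReal.ofReal δ) (ENNReal.ofReal_pos.2 hδ)).exists
  refine ⟨P[g | ℱ n], (stronglyMeasurable_condExp.mono (ℱ.le n)).measurable, integrable_condExp,
    ?_, ?_⟩
  · refine integral_abs_le_of_eLpNorm_le (hgi.sub integrable_condExp) hδ.le ?_
    refine le_trans (le_of_eq ?_) hn
    have h2 : eLpNorm (P[g | ℱ n] - P[g | ⨆ n, ℱ n]) 1 P = eLpNorm (P[g | ℱ n] - g) 1 P :=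
      eLpNorm_congr_ae (EventuallyEq.rfl.sub hsupg)
    rw [h2, ← eLpNorm_neg, neg_sub]
  · exact centeredAverages_of_stronglyMeasurable_pull hT hY hXm hX hinf (m := n + 1)
      stronglyMeasurable_condExp integrable_condExp
      (ae_bdd_abs_condExp_of_ae_bdd_abs (Eventually.of_forall hgC))

/-- For a conditional K-automorphism all centred averages vanish almost surely. -/
theorem centeredAverages_of_isCondKAutomorphism
    (hT : ∀ k : ℤ, MeasurePreserving (iter T k) P P) (hY : Y ≤ mΩ)
    (hK : IsCondKAutomorphism (obs T Y (Set.Iic 0)) P T) {f : Ω → ℝ} (hfm : Measurable f)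
    (hf : Integrable f P) : CenteredAverages Y P T (AsNull P) f :=
  let ⟨X, hXm, hX, hsup, hinf⟩ := hK
  @centeredAverages_of_exhausting Ω Y X mΩ P _ T hT hY hXm hX hsup hinf f hfm hf

end KAutomorphism

/-! ### Conditional weak mixing: convergence in probability -/

lemma IsAvgMode.congr_ae [MeasurableSpace Ω] {P : Measure Ω} {T : Equiv.Perm Ω}
    {Null : (ℕ → Ω → ℝ) → Prop} (H : IsAvgMode P T Null) {a b : ℕ → Ω → ℝ}
    (h : ∀ k, 1 ≤ k → a k =ᵐ[P] b k) (hb : Null b) : Null a := by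
  refine H.approx _ fun ε hε => ⟨b, fun _ => 0, hb, measurable_const, integrable_zero _ _ _,
    fun _ => le_rfl, by simpa using hε.le, fun k hk => ?_⟩
  filter_upwards [h k hk] with ω hω
  rw [hω, sub_self, abs_zero]

lemma MeasNull.const_mul [MeasurableSpace Ω] {P : Measure Ω} {a : ℕ → Ω → ℝ} (ha : MeasNull P a)
    (c : ℝ) : MeasNull P fun k ω => c * a k ω := by
  have havg : ∀ N ω, avg (fun k ω => c * a k ω) N ω = c * avg a N ω := fun N ω => by
    simp only [avg, ← Finset.mul_sum]
    ring
  intro r hr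
  simp only [havg, abs_mul]
  rcases eq_or_ne c 0 with rfl | hc
  · simp [hr.not_ge]
  · have hc' : 0 < |c| := abs_pos.2 hc
    simpa only [div_le_iff₀' hc'] using ha (r / |c|) (by positivity)

lemma measNull_of_tendsto_integral_sq [MeasurableSpace Ω] {P : Measure Ω} [IsProbabilityMeasure P]
    {a : ℕ → Ω → ℝ} (hi : ∀ N, Integrable (fun ω => avg a N ω ^ 2) P)
    (h : Tendsto (fun N => ∫ ω, avg a N ω ^ 2 ∂P) atTop (𝓝 0)) : MeasNull P a := by
  intro r hr
  have h1 : Tendsto (fun N => ENNReal.ofReal ((∫ ω, avg a N ω ^ 2 ∂P) / r ^ 2)) atTop (𝓝 0) := by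
    have := (ENNReal.continuous_ofReal.tendsto _).comp (h.div_const (r ^ 2))
    simpa [Function.comp_def] using this
  refine tendsto_of_tendsto_of_tendsto_of_le_of_le tendsto_const_nhds h1 (fun _ => zero_le)
    fun N => ?_
  have h2 : {ω | r ≤ |avg a N ω|} = {ω | r ^ 2 ≤ avg a N ω ^ 2} := by
    ext ω
    simp only [Set.mem_ofPred_eq]
    rw [← sq_abs (avg a N ω)]
    exact (pow_le_pow_iff_left₀ hr.le (abs_nonneg _) two_ne_zero).symm
  rw [h2, ← ofReal_measureReal (measure_ne_top P _)]
  refine ENNReal.ofReal_le_ofReal ?_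
  rw [le_div_iff₀ (by positivity), mul_comm]
  exact mul_meas_ge_le_integral_of_nonneg (Eventually.of_forall fun ω => sq_nonneg _) (hi N) _

/-- On either side of the diagonal each distance `|k - l|` occurs at most once, whence the factor
`2`. -/
lemma sum_row_le {b : ℕ → ℝ} {α : ℕ → ℝ} (hα : ∀ n, 0 ≤ α n) {D : ℝ} {k N : ℕ}
    (hk : k ∈ Finset.Icc 1 N) (hlt : ∀ l, 1 ≤ l → l < k → b l ≤ α (k - l)) (heq : b k ≤ D)
    (hgt : ∀ l, k < l → b l ≤ α (l - k)) :
    ∑ l ∈ Finset.Icc 1 N, b l ≤ D + 2 * ∑ n ∈ Finset.Icc 1 N, α n := by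
  obtain ⟨hk1, hkN⟩ := Finset.mem_Icc.1 hk
  have h1 : ∑ l ∈ Finset.Icc 1 N, b l
      = ∑ l ∈ Finset.Ico 1 k, b l + b k + ∑ l ∈ Finset.Ioc k N, b l := by
    have e1 : ∑ l ∈ Finset.Icc 1 N, b l
        = ∑ l ∈ Finset.Icc 1 k, b l + ∑ l ∈ Finset.Ioc k N, b l :=
      (Finset.sum_Ioc_consecutive b (Nat.zero_le k) hkN).symm
    have e2 : ∑ l ∈ Finset.Icc 1 k, b l = ∑ l ∈ Finset.Ico 1 k, b l + b k :=
      Finset.sum_Ico_succ_top hk1 b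
    rw [e1, e2]
  have h2 : ∑ l ∈ Finset.Ico 1 k, b l ≤ ∑ n ∈ Finset.Icc 1 N, α n := by
    refine (Finset.sum_le_sum (g := fun l => α (k - l)) fun l hl =>
      hlt l (Finset.mem_Ico.1 hl).1 (Finset.mem_Ico.1 hl).2).trans ?_
    have hinj : Set.InjOn (fun l => k - l) (Finset.Ico 1 k : Finset ℕ) := by
      intro x hx y hy hxy
      simp only [Finset.coe_Ico, Set.mem_Ico] at hx hy hxy
      omega
    rw [← Finset.sum_image (f := α) hinj]
    refine Finset.sum_le_sum_of_subset_of_nonneg (fun n hn => ?_) fun n _ _ => hα n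
    obtain ⟨l, hl, rfl⟩ := Finset.mem_image.1 hn
    rw [Finset.mem_Ico] at hl
    rw [Finset.mem_Icc]
    omega
  have h3 : ∑ l ∈ Finset.Ioc k N, b l ≤ ∑ n ∈ Finset.Icc 1 N, α n := by
    refine (Finset.sum_le_sum (g := fun l => α (l - k)) fun l hl =>
      hgt l (Finset.mem_Ioc.1 hl).1).trans ?_
    have hinj : Set.InjOn (fun l => l - k) (Finset.Ioc k N : Finset ℕ) := by
      intro x hx y hy hxy
      simp only [Finset.coe_Ioc, Set.mem_Ioc] at hx hy hxy
      omega
    rw [← Finset.sum_image (f := α) hinj]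
    refine Finset.sum_le_sum_of_subset_of_nonneg (fun n hn => ?_) fun n _ _ => hα n
    obtain ⟨l, hl, rfl⟩ := Finset.mem_image.1 hn
    rw [Finset.mem_Ioc] at hl
    rw [Finset.mem_Icc]
    omega
  linarith

lemma iter_image_eq_preimage (T : Equiv.Perm Ω) (n : ℤ) (A : Set Ω) :
    iter T n '' A = iter T (-n) ⁻¹' A := by
  ext ω
  constructor
  · rintro ⟨x, hx, rfl⟩
    simpa [iter_neg_iter] using hx
  · exact fun h => ⟨iter T (-n) ω, h, iter_iter_neg T n ω⟩

lemma abs_indicator_one_le (A : Set Ω) (ω : Ω) : |A.indicator (fun _ => (1 : ℝ)) ω| ≤ 1 := by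
  by_cases h : ω ∈ A <;> simp [h]

lemma abs_condProb_le {Z : MeasurableSpace Ω} [MeasurableSpace Ω] {P : Measure Ω} (A : Set Ω) :
    ∀ᵐ ω ∂P, |condProb Z P A ω| ≤ 1 :=
  ae_bdd_abs_condExp_of_ae_bdd_abs (Eventually.of_forall (abs_indicator_one_le A))

lemma CenteredAverages.finset_sum {Y : MeasurableSpace Ω} [mΩ : MeasurableSpace Ω]
    {P : Measure Ω} {T : Equiv.Perm Ω} {Null : (ℕ → Ω → ℝ) → Prop}
    (hT : ∀ k : ℤ, MeasurePreserving (iter T k) P P) (H : IsAvgMode P T Null)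
    {ι : Type*} (s : Finset ι) {f : ι → Ω → ℝ} (hi : ∀ i ∈ s, Integrable (f i) P)
    (hf : ∀ i ∈ s, CenteredAverages Y P T Null (f i)) :
    CenteredAverages Y P T Null (∑ i ∈ s, f i) := by
  intro B hB
  refine H.congr_ae (fun k _ => ?_) (H.sum s _ fun i hi => hf i hi B hB)
  filter_upwards [(hT k).quasiMeasurePreserving.ae
    (condExp_finsetSum (μ := P) hi (obs T Y (Set.Iic 0)))] with ω hω
  by_cases h : ω ∈ B k
  · simp only [Set.indicator_of_mem h, hω, Finset.sum_apply, Finset.sum_sub_distrib]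
  · simp only [Set.indicator_of_notMem h, Finset.sum_const_zero]

section WeakMixing

variable {Y Z : MeasurableSpace Ω} [mΩ : MeasurableSpace Ω] {P : Measure Ω}
  [IsProbabilityMeasure P] {T : Equiv.Perm Ω}

/-- The deviation from conditional independence of `A` and `T^n A`. -/
def condCov (Z : MeasurableSpace Ω) {mΩ : MeasurableSpace Ω} (P : Measure Ω) (T : Equiv.Perm Ω)
    (A : Set Ω) (n : ℕ) (ω : Ω) : ℝ :=
  condProb Z P (A ∩ iter T n '' A) ω - condProb Z P A ω * condProb Z P (iter T n '' A) ω

/-- Since `T^n Z ⊆ Z`, both `P[A | Z]` and its composition with `T^{-n}` are `Z`-measurable and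
factor out. The terms containing the latter cancel, so it need not equal `P[T^n A | Z]`. -/
lemma condExp_centered_mul (hT : ∀ k : ℤ, MeasurePreserving (iter T k) P P) (hZ : Z ≤ mΩ)
    (hinv : ∀ n : ℕ, pull T (-(n : ℤ)) Z ≤ Z) {A : Set Ω} (hA : MeasurableSet A) (n : ℕ) :
    P[fun ω => (A.indicator (fun _ => (1 : ℝ)) (iter T (-(n : ℤ)) ω)
        - condProb Z P A (iter T (-(n : ℤ)) ω))
        * (A.indicator (fun _ => (1 : ℝ)) ω - condProb Z P A ω) | Z]
      =ᵐ[P] condCov Z P T A n := by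
  set An := iter T n '' A with hAn
  have hAn' : An = iter T (-(n : ℤ)) ⁻¹' A := iter_image_eq_preimage T n A
  have hAnm : MeasurableSet An := by rw [hAn']; exact (hT _).measurable hA
  set f : Ω → ℝ := A.indicator fun _ => 1 with hf
  set fn : Ω → ℝ := An.indicator fun _ => 1 with hfn
  set p : Ω → ℝ := condProb Z P A with hp
  set pn : Ω → ℝ := fun ω => p (iter T (-(n : ℤ)) ω) with hpn
  have hfcomp : ∀ ω, f (iter T (-(n : ℤ)) ω) = fn ω := fun ω => by
    rw [hf, hfn, hAn']
    rfl
  have hpm : StronglyMeasurable[Z] p := stronglyMeasurable_condExp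
  have hpnm : StronglyMeasurable[Z] pn :=
    (hpm.comp_measurable (measurable_iter_pull T _ Z)).mono (hinv n)
  have hfm : StronglyMeasurable f := stronglyMeasurable_const.indicator hA
  have hfnm : StronglyMeasurable fn := stronglyMeasurable_const.indicator hAnm
  have hfi : Integrable f P := (integrable_const 1).indicator hA
  have hfni : Integrable fn P := (integrable_const 1).indicator hAnm
  have hf1 : ∀ᵐ ω ∂P, |f ω| ≤ 1 := Eventually.of_forall (abs_indicator_one_le A)
  have hfn1 : ∀ᵐ ω ∂P, |fn ω| ≤ 1 := Eventually.of_forall (abs_indicator_one_le An)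
  have hp1 : ∀ᵐ ω ∂P, |p ω| ≤ 1 := abs_condProb_le A
  have hpn1 : ∀ᵐ ω ∂P, |pn ω| ≤ 1 := (hT _).quasiMeasurePreserving.ae hp1
  have hpZ := (hpm.mono hZ).aestronglyMeasurable (μ := P)
  have hpnZ := (hpnm.mono hZ).aestronglyMeasurable (μ := P)
  have i1 : Integrable (fn * f) P :=
    integrable_mul_of_bounded hfnm.aestronglyMeasurable hfm.aestronglyMeasurable hfn1 hf1
  have i2 : Integrable (pn * f) P :=
    integrable_mul_of_bounded hpnZ hfm.aestronglyMeasurable hpn1 hf1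
  have i3 : Integrable (p * fn) P :=
    integrable_mul_of_bounded hpZ hfnm.aestronglyMeasurable hp1 hfn1
  have i4 : Integrable (pn * p) P := integrable_mul_of_bounded hpnZ hpZ hpn1 hp1
  have hexp : (fun ω => (f (iter T (-(n : ℤ)) ω) - p (iter T (-(n : ℤ)) ω)) * (f ω - p ω))
      = fn * f - pn * f - p * fn + pn * p := by
    funext ω
    simp only [Pi.add_apply, Pi.sub_apply, Pi.mul_apply, hfcomp]
    ring
  have hinter : fn * f = (A ∩ An).indicator fun _ => (1 : ℝ) := by
    funext ω
    by_cases h1 : ω ∈ A <;> by_cases h2 : ω ∈ An <;> simp [hf, hfn, h1, h2]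
  rw [hexp]
  filter_upwards [condExp_add ((i1.sub i2).sub i3) i4 Z, condExp_sub (i1.sub i2) i3 Z,
    condExp_sub i1 i2 Z, condExp_mul_of_stronglyMeasurable_left hpnm i2 hfi,
    condExp_mul_of_stronglyMeasurable_left hpm i3 hfni] with ω h1 h2 h3 h4 h5
  have h6 : P[pn * p | Z] = pn * p := condExp_of_stronglyMeasurable hZ (hpnm.mul hpm) i4
  rw [h1, Pi.add_apply, h2, Pi.sub_apply, h3, Pi.sub_apply, h4, h5, h6, hinter]
  simp only [Pi.mul_apply, condCov]
  have h7 : (P[f | Z]) ω = p ω := rfl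
  have h8 : (P[fn | Z]) ω = condProb Z P An ω := rfl
  have h9 : (P[(A ∩ An).indicator fun _ => (1 : ℝ) | Z]) ω = condProb Z P (A ∩ An) ω := rfl
  rw [h7, h8, h9]
  ring

lemma integrable_condCov (hZ : Z ≤ mΩ) (A : Set Ω) (n : ℕ) : Integrable (condCov Z P T A n) P :=
  integrable_condExp.sub (integrable_mul_of_bounded
    (stronglyMeasurable_condExp.mono hZ).aestronglyMeasurable
    (stronglyMeasurable_condExp.mono hZ).aestronglyMeasurable (abs_condProb_le A)
    (abs_condProb_le _))

/-- The correlation of two terms of the centred sequence is controlled by `condCov`. -/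
lemma abs_integral_centered_mul_le (hT : ∀ k : ℤ, MeasurePreserving (iter T k) P P) (hZ : Z ≤ mΩ)
    (hinv : ∀ n : ℕ, pull T (-(n : ℤ)) Z ≤ Z) {A : Set Ω} (hA : MeasurableSet A) {k l : ℕ}
    (hkl : k ≤ l) {B : Set Ω} (hB : MeasurableSet[pull T l Z] B) :
    |∫ ω in B, (A.indicator (fun _ => (1 : ℝ)) (iter T k ω) - condProb Z P A (iter T k ω))
        * (A.indicator (fun _ => (1 : ℝ)) (iter T l ω) - condProb Z P A (iter T l ω)) ∂P|
      ≤ ∫ ω, |condCov Z P T A (l - k) ω| ∂P := by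
  -- The product is `e ∘ T^l`. Conditioning on `T^{-l} Z`, which contains `B`, and shifting back
  -- reduces the claim to `E[e | Z]`.
  set e : Ω → ℝ := fun ω => (A.indicator (fun _ => (1 : ℝ)) (iter T (-((l - k : ℕ) : ℤ)) ω)
        - condProb Z P A (iter T (-((l - k : ℕ) : ℤ)) ω))
        * (A.indicator (fun _ => (1 : ℝ)) ω - condProb Z P A ω) with he
  have hcomp : ∀ ω, (A.indicator (fun _ => (1 : ℝ)) (iter T k ω) - condProb Z P A (iter T k ω))
        * (A.indicator (fun _ => (1 : ℝ)) (iter T l ω) - condProb Z P A (iter T l ω))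
      = e (iter T l ω) := fun ω => by
    simp only [he, ← iter_add]
    have : -((l - k : ℕ) : ℤ) + l = k := by omega
    rw [this]
  simp only [hcomp]
  have hd1 : ∀ᵐ ω ∂P, |A.indicator (fun _ => (1 : ℝ)) ω - condProb Z P A ω| ≤ 1 + 1 := by
    filter_upwards [abs_condProb_le (Z := Z) (P := P) A] with ω hω
    exact (abs_sub _ _).trans (add_le_add (abs_indicator_one_le A ω) hω)
  have hdm : StronglyMeasurable fun ω => A.indicator (fun _ => (1 : ℝ)) ω - condProb Z P A ω :=
    (stronglyMeasurable_const.indicator hA).sub (stronglyMeasurable_condExp.mono hZ)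
  have hei : Integrable e P :=
    integrable_mul_of_bounded (hdm.comp_measurable (hT _).measurable).aestronglyMeasurable
      hdm.aestronglyMeasurable ((hT _).quasiMeasurePreserving.ae hd1) hd1
  have hle : pull T l Z ≤ mΩ := pull_le hT l hZ
  have hel : Integrable (fun ω => e (iter T l ω)) P := (hT l).integrable_comp_of_integrable hei
  rw [← setIntegral_condExp hle hel hB]
  refine abs_integral_le_integral_abs.trans ?_
  refine (setIntegral_le_integral integrable_condExp.abs
    (Eventually.of_forall fun ω => abs_nonneg _)).trans (le_of_eq ?_)
  have h1 := condExp_centered_mul hT hZ hinv hA (l - k)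
  rw [← integral_comp_iter (hT l) (integrable_condCov hZ A (l - k)).abs.1]
  refine integral_congr_ae ?_
  filter_upwards [condExp_pull hT hZ hei l, (hT l).quasiMeasurePreserving.ae h1] with ω h2 h3
  simp only [h2]
  rw [← h3]

lemma tendsto_avg_integral_condCov (hZ : Z ≤ mΩ) (hWM : IsCondWeakMixing Z P T) {A : Set Ω}
    (hA : MeasurableSet A) :
    Tendsto (fun N : ℕ => (1 / (N : ℝ)) *
      ∑ k ∈ Finset.Icc 1 N, ∫ ω, |condCov Z P T A k ω| ∂P) atTop (𝓝 0) := by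
  have h1 := (ENNReal.tendsto_toReal ENNReal.zero_ne_top).comp (hWM A A hA hA)
  refine h1.congr fun N => ?_
  have h2 : ∫ ω, avg (fun k ω => |condCov Z P T A k ω|) N ω ∂P
      = (1 / (N : ℝ)) * ∑ k ∈ Finset.Icc 1 N, ∫ ω, |condCov Z P T A k ω| ∂P := by
    simp only [avg]
    rw [integral_const_mul, integral_finsetSum]
    exact fun k _ => (integrable_condCov hZ A k).abs
  have h3 : Integrable (avg (fun k ω => |condCov Z P T A k ω|) N) P :=
    (integrable_finsetSum _ fun k _ => (integrable_condCov hZ A k).abs).const_mul _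
  rw [← h2, Function.comp_apply, eLpNorm_one_eq_lintegral_enorm]
  have h4 := integral_norm_eq_lintegral_enorm h3.1
  refine h4.symm.trans (integral_congr_ae (Eventually.of_forall fun ω => ?_))
  exact Real.norm_of_nonneg (avg_nonneg fun k _ => abs_nonneg _)

/-- For `k < l` the set `B_k ∩ B_l` belongs to `𝒴_{-∞,l} = T^{-l} Z`, so the correlation is at most
the mean conditional covariance at lag `l - k`. The average of these over the lags tends to zero by
weak mixing. -/
lemma centeredAverages_indicator (hT : ∀ k : ℤ, MeasurePreserving (iter T k) P P) (hY : Y ≤ mΩ)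
    (hWM : IsCondWeakMixing (obs T Y (Set.Iic 0)) P T) {A : Set Ω} (hA : MeasurableSet A) :
    CenteredAverages Y P T (MeasNull P) (A.indicator fun _ => 1) := by
  intro B hB
  have hZ : obs T Y (Set.Iic 0) ≤ mΩ := obs_le hT hY _
  have hinv : ∀ n : ℕ, pull T (-(n : ℤ)) (obs T Y (Set.Iic 0)) ≤ obs T Y (Set.Iic 0) := fun n => by
    rw [← obs_Iic_eq_pull]
    exact obs_mono T Y (Set.Iic_subset_Iic.2 (by omega))
  set d : Ω → ℝ := fun ω => A.indicator (fun _ => (1 : ℝ)) ω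
    - condProb (obs T Y (Set.Iic 0)) P A ω with hd
  set a : ℕ → Ω → ℝ := fun k => (B k).indicator fun ω => d (iter T k ω) with ha
  have hd1 : ∀ᵐ ω ∂P, |d ω| ≤ 1 + 1 := by
    filter_upwards [abs_condProb_le (Z := obs T Y (Set.Iic 0)) (P := P) A] with ω hω
    exact (abs_sub _ _).trans (add_le_add (abs_indicator_one_le A ω) hω)
  have hdm : StronglyMeasurable d :=
    (stronglyMeasurable_const.indicator hA).sub (stronglyMeasurable_condExp.mono hZ)
  have hBm : ∀ k, 1 ≤ k → MeasurableSet (B k) := fun k hk => obs_le hT hY _ _ (hB k hk)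
  have ham : ∀ k, 1 ≤ k → AEStronglyMeasurable (a k) P := fun k hk =>
    ((hdm.comp_measurable (hT k).measurable).indicator (hBm k hk)).aestronglyMeasurable
  have ha1 : ∀ k : ℕ, ∀ᵐ ω ∂P, |a k ω| ≤ 1 + 1 := fun k => by
    filter_upwards [(hT k).quasiMeasurePreserving.ae hd1] with ω hω
    by_cases h : ω ∈ B k
    · simpa only [ha, Set.indicator_of_mem h] using hω
    · simp only [ha, Set.indicator_of_notMem h, abs_zero]
      norm_num
  have hi : ∀ k l, 1 ≤ k → 1 ≤ l → Integrable (fun ω => a k ω * a l ω) P := fun k l hk hl =>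
    integrable_mul_of_bounded (ham k hk) (ham l hl) (ha1 k) (ha1 l)
  set α : ℕ → ℝ := fun n => ∫ ω, |condCov (obs T Y (Set.Iic 0)) P T A n ω| ∂P with hα
  have hα0 : ∀ n, 0 ≤ α n := fun n => integral_nonneg fun ω => abs_nonneg _
  have hcov : ∀ k l, 1 ≤ k → k < l → ∫ ω, a k ω * a l ω ∂P ≤ α (l - k) := by
    intro k l hk hkl
    have hBl : MeasurableSet[pull T l (obs T Y (Set.Iic 0))] (B k ∩ B l) := by
      rw [← obs_Iic_eq_pull]
      exact (obs_mono T Y (Set.Iic_subset_Iic.2 (by exact_mod_cast hkl.le)) _ (hB k hk)).inter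
        (hB l (hk.trans hkl.le))
    have h1 := abs_integral_centered_mul_le hT hZ hinv hA hkl.le hBl
    refine le_trans (le_of_eq ?_) ((le_abs_self _).trans h1)
    rw [← integral_indicator ((hBm k hk).inter (hBm l (hk.trans hkl.le)))]
    refine integral_congr_ae (Eventually.of_forall fun ω => ?_)
    by_cases h2 : ω ∈ B k <;> by_cases h3 : ω ∈ B l <;> simp [ha, hd, h2, h3]
  -- The diagonal contributes `4/N`, the terms being bounded by `2`; the two sides of the diagonal
  -- contribute the average covariance twice.
  have hsq : ∀ N, ∫ ω, avg a N ω ^ 2 ∂P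
      ≤ 4 / (N : ℝ) + 2 * ((1 / (N : ℝ)) * ∑ n ∈ Finset.Icc 1 N, α n) := by
    intro N
    rw [integral_avg_sq_eq a N hi]
    have hrow : ∀ k ∈ Finset.Icc 1 N, ∑ l ∈ Finset.Icc 1 N, ∫ ω, a k ω * a l ω ∂P
        ≤ 4 + 2 * ∑ n ∈ Finset.Icc 1 N, α n := fun k hk => by
      have hk1 := (Finset.mem_Icc.1 hk).1
      refine sum_row_le hα0 hk (fun l hl hlk => ?_) ?_ fun l hkl => hcov k l hk1 hkl
      · simp only [mul_comm (a k _)]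
        exact hcov l k hl hlk
      · have h2 : ∫ ω, a k ω * a k ω ∂P ≤ ∫ _, 4 ∂P := by
          refine integral_mono_ae (hi k k hk1 hk1) (integrable_const _) ?_
          filter_upwards [ha1 k] with ω hω
          rw [← abs_mul_abs_self]
          nlinarith [abs_nonneg (a k ω)]
        simpa using h2
    refine (mul_le_mul_of_nonneg_left (Finset.sum_le_sum hrow) (by positivity)).trans (le_of_eq ?_)
    rw [Finset.sum_const, Nat.card_Icc, nsmul_eq_mul]
    rcases Nat.eq_zero_or_pos N with rfl | hN
    · simp
    · have : (N : ℝ) ≠ 0 := by positivity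
      simp only [Nat.add_sub_cancel]
      field_simp
  refine measNull_of_tendsto_integral_sq (fun N => ?_) ?_
  · have hall : ∀ᵐ ω ∂P, ∀ k, |a k ω| ≤ 1 + 1 := ae_all_iff.2 ha1
    have hb : ∀ᵐ ω ∂P, |avg a N ω| ≤ 1 / (N : ℝ) * ∑ k ∈ Finset.Icc 1 N, (1 + 1) := by
      filter_upwards [hall] with ω hω
      exact (abs_avg_le _ _ _).trans
        (avg_mono (b := fun (_ : ℕ) (_ : Ω) => 1 + 1) fun k _ => hω k)
    have h1 : AEMeasurable (fun ω => ∑ k ∈ Finset.Icc 1 N, a k ω) P :=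
      Finset.aemeasurable_fun_sum _ fun k hk => (ham k (Finset.mem_Icc.1 hk).1).aemeasurable
    have h2 : AEStronglyMeasurable (avg a N) P := (h1.const_mul _).aestronglyMeasurable
    simp only [sq]
    exact integrable_mul_of_bounded h2 h2 hb hb
  · have h3 : Tendsto (fun N : ℕ => 4 / (N : ℝ) + 2 * ((1 / (N : ℝ)) *
        ∑ n ∈ Finset.Icc 1 N, α n)) atTop (𝓝 0) := by
      simpa using (tendsto_const_div_atTop_nhds_zero_nat (4 : ℝ)).add
        ((tendsto_avg_integral_condCov hZ hWM hA).const_mul 2)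
    exact squeeze_zero (fun N => integral_nonneg fun ω => sq_nonneg _) hsq h3

lemma CenteredAverages.const_mul {f : Ω → ℝ} (hT : ∀ k : ℤ, MeasurePreserving (iter T k) P P)
    (hf : CenteredAverages Y P T (MeasNull P) f) (c : ℝ) :
    CenteredAverages Y P T (MeasNull P) fun ω => c * f ω := by
  intro B hB
  refine (isAvgMode_measNull hT).congr_ae (fun k _ => ?_) ((hf B hB).const_mul c)
  filter_upwards [(hT k).quasiMeasurePreserving.ae
    (condExp_smul (μ := P) c f (obs T Y (Set.Iic 0)))] with ω hω
  have h1 : (P[fun ω => c * f ω | obs T Y (Set.Iic 0)]) (iter T k ω)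
      = c * (P[f | obs T Y (Set.Iic 0)]) (iter T k ω) := hω
  by_cases h : ω ∈ B k
  · simp only [Set.indicator_of_mem h, h1]
    ring
  · simp only [Set.indicator_of_notMem h, mul_zero]

/-- Under conditional weak mixing all centred averages vanish in probability. -/
theorem centeredAverages_of_isCondWeakMixing
    (hT : ∀ k : ℤ, MeasurePreserving (iter T k) P P) (hY : Y ≤ mΩ)
    (hWM : IsCondWeakMixing (obs T Y (Set.Iic 0)) P T) {f : Ω → ℝ} (hfm : Measurable f)
    (hf : Integrable f P) : CenteredAverages Y P T (MeasNull P) f := by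
  refine CenteredAverages.of_approx hT hY (isAvgMode_measNull hT) hfm hf fun ε hε => ?_
  obtain ⟨n, hn⟩ := (ENNReal.tendsto_nhds_zero.1
    (SimpleFunc.tendsto_approxOn_range_L1_enorm hfm hf) (ENNReal.ofReal ε)
    (ENNReal.ofReal_pos.2 hε)).exists
  set g := SimpleFunc.approxOn f hfm (Set.range f ∪ {0}) 0 (by simp) n
  have hgi : Integrable g P := SimpleFunc.integrable_approxOn_range hfm hf n
  refine ⟨g, g.measurable, hgi, integral_abs_le_of_eLpNorm_le (hf.sub hgi) hε.le ?_, ?_⟩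
  · rw [eLpNorm_one_eq_lintegral_enorm]
    simpa only [Pi.sub_apply, enorm_sub_rev] using hn
  · rw [simpleFunc_eq_sum_indicator g]
    refine CenteredAverages.finset_sum hT (isAvgMode_measNull hT) _
      (fun y _ => (integrable_const y).indicator (g.measurableSet_fiber y)) fun y _ => ?_
    have h1 := (centeredAverages_indicator hT hY hWM (g.measurableSet_fiber y)).const_mul hT y
    convert h1 using 1
    funext ω
    by_cases h : ω ∈ g ⁻¹' {y} <;> simp [h]

end WeakMixing

end PathwiseDecision

end

theorem mainTheorem9 {Ω U : Type*} (Y : MeasurableSpace Ω) [mΩ : MeasurableSpace Ω] (hY : Y ≤ mΩ)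
    [MeasurableSpace U] [Nonempty U]
    (P : Measure Ω) [IsProbabilityMeasure P]
    (T : Ω ≃ᵐ Ω) (hT : Ergodic T P)
    (ℓ : U → Ω → ℝ) (hℓ : Measurable (Function.uncurry ℓ))
    (Λ : Ω → ℝ) (hΛ : Integrable Λ P) (hdom : ∀ u ω, |ℓ u ω| ≤ Λ ω)
    (hequi : PathwiseDecision.Equimeasurable P ℓ)
    (hsep : PathwiseDecision.PointwiseSeparable P ℓ) :
    (∃ u : ℕ → Ω → U, PathwiseDecision.IsMeanOptimalSelection Y P T.toEquiv ℓ u) ∧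
    (PathwiseDecision.IsCondKAutomorphism
        (PathwiseDecision.obs T.toEquiv Y (Set.Iic 0)) P T.toEquiv →
      ∀ u : ℕ → Ω → U, PathwiseDecision.IsMeanOptimalSelection Y P T.toEquiv ℓ u →
        PathwiseDecision.PathwiseOptimal Y P T.toEquiv ℓ u) ∧
    (PathwiseDecision.IsCondWeakMixing
        (PathwiseDecision.obs T.toEquiv Y (Set.Iic 0)) P T.toEquiv →
      ∀ u : ℕ → Ω → U, PathwiseDecision.IsMeanOptimalSelection Y P T.toEquiv ℓ u →
        PathwiseDecision.WeaklyPathwiseOptimal Y P T.toEquiv ℓ u) := by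
  have hTk := PathwiseDecision.measurePreserving_iter T hT.toMeasurePreserving
  refine ⟨PathwiseDecision.exists_isMeanOptimalSelection Y hY hTk hℓ hΛ hdom hequi hsep,
    fun hK u hu => ?_, fun hW u hu => ?_⟩
  · exact PathwiseDecision.pathwiseOptimal_of_centeredAverages hTk hY
      (fun f hfm hf => PathwiseDecision.centeredAverages_of_isCondKAutomorphism hTk hY hK hfm hf)
      hℓ hΛ hdom hequi hsep hu
  · exact PathwiseDecision.weaklyPathwiseOptimal_of_centeredAverages hTk hY
      (fun f hfm hf => PathwiseDecision.centeredAverages_of_isCondWeakMixing hTk hY hW hfm hf)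
      hℓ hΛ hdom hequi hsep hu
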